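/- **Setting.** Let $L,\nu>0$, let $\mathbb T^3=[0,L]^3$ with periodic boundary conditions, and put $\lambda_q=2^q/L$ for $q\in\mathbb Z$ and $\kappa_0=2\pi\lambda_0=2\pi/L$. Consider the Navier–Stokes equations $u_t+(u\cdot\nabla)u-\nu\Delta u+\nabla p=f$, $\nabla\cdot u=0$ on $\mathbb T^3$, where $u(t)$ and $f(t)$ have zero mean and $f$ is translationally bounded in $L^2_{\rm loc}(\mathbb R;H^{-1})$. Fix a nonnegative radial $\chi\in C_c^\infty(\mathbb R^3)$ with $\chi=1$ for $|\xi|\le 3/4$ and $\chi=0$ for $|\xi|\ge1$; let $\varphi(\xi)=\chi(\xi/2)-\chi(\xi)$, $\varphi_{-1}=\chi$, $\varphi_q(\xi)=\varphi(2^{-q}\xi)$ for $q\ge0$, $u_q(x)=\sum_{k\in\mathbb Z^3}\varphi_q(k)\hat u(k)e^{i\frac{2\pi}{L}k\cdot x}$, $u_{\le q}=\sum_{p=-1}^{q}u_p$, and $\|g\|_{H^{s}}^2=\sum_{q\ge-1}\lambda_q^{2s}\|g_q\|_{L^2}^2$. Let $C_B$ be a constant for which Bernstein's inequality $\lambda_q^{-1}\|v_q\|_{L^\infty}^2\le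 C_B\lambda_q^2\|v_q\|_{L^2}^2$ holds for all $q\ge0$, all $L>0$ and all $v\in L^2(\mathbb T^3;\mathbb R^3)$. A *weak solution* on $[0,\infty)$ is a (zero mean, divergence free) $u\in C([0,\infty);L^2_{\rm w})\cap L^2_{\rm loc}(0,\infty;H^1)$ that satisfies the equations in the sense of distributions. It is a *Leray–Hopf solution* if, for almost all $t_0>0$ and all $t>t_0$, $$\tfrac12\|u(t)\|_{L^2}^2\le\tfrac12\|u(t_0)\|_{L^2}^2-\nu\int_{t_0}^t\|\nabla u\|_{L^2}^2\,d\tau+\int_{t_0}^t(f,u)\,d\tau .$$ A *complete* Leray–Hopf solution is a function $u$ on $\mathbb R$ such that for every $s\in\mathbb R$ the translate $u(\cdot-s)|_{[0,\infty)}$ is a Leray–Hopf solution (with force $f(\cdot-s)$). For $T>0$ let $\langle g\rangle=\langle g\rangle(t)=\frac1T\int_t^{t+T}g(\tau)\,d\tau$. Let $\delta>0$, and let $c_0>0$ be a constant depending only on $\delta$. The *determining wavenumber* is $$\Lambda_u(t)=\min\Big\{\lambda_q:\ q\in\mathbb N=\{0,1,2,\dots\},\ (L\lambda_{p-q})^{\frac{\delta-1}2}\lambda_q^{-1}\|u_p(t)\|_{L^\infty}<c_0\nu\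 \ \forall p>q,\ \ \lambda_q^{-2}\|\nabla u_{\le q}(t)\|_{L^\infty}<c_0\nu\Big\}$$ ($=+\infty$ if there is no such $q$). The *intermittency dimension* $d=d(u,t)$ on $[t,t+T]$ is $$d=\sup\Big\{s\in\mathbb R:\ \Big\langle\sum_{q}\lambda_q^{-1+s}\|u_q\|_{L^\infty}^2\Big\rangle\le C_B^{3-s}\lambda_0^{s}\Big\langle\sum_q\lambda_q^2\|u_q\|_{L^2}^2\Big\rangle\Big\},$$ and $d=3$ if $u\equiv0$ on $[t,t+T]$. Kolmogorov's dissipation wavenumber is $$\kappa_{\rm d}=\Big(\frac{\varepsilon}{\nu^3}\Big)^{\frac1{d+1}},\qquad \varepsilon=\lambda_0^d\,\nu\,\langle\|\nabla u\|_{L^2}^2\rangle .$$ The Grashof number is $$G=\frac{T^{1/2}\kappa_0^{1/2}\|f\|_{L^2_b(T)}}{\nu^{3/2}(1-e^{-\nu\kappa_0^2T})^{1/2}},\qquad \|f\|_{L^2_b(T)}^2=\sup_{t\in\mathbb R}\frac1T\int_t^{t+T}\|f(\tau)\|_{H^{-1}}^2\,d\tau,$$ and, for a time-independent force, $G=\|f\|_{H^{-1}}/(\nu^2\kappa_0^{1/2})$.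 **Theorem.** Let $\delta>0$ and $d\in[\delta,3)$. There is an adimensional constant $C_{\delta,d}>0$, depending only on $\delta$ and $d$ (and on the fixed choices of $\chi$, $C_B$ and $c_0$), such that for all $L,\nu,T>0$, all $f$ as above, every complete Leray–Hopf solution $u$ bounded in $L^2$, and every $t\in\mathbb R$ such that the intermittency dimension of $u$ on $[t,t+T]$ is $d$, $$\langle\Lambda_u\rangle-\lambda_0\ \le\ C_{\delta,d}\,\kappa_{\rm d}\ \le\ C_{\delta,d}\,\kappa_0\,G^{\frac2{d+1}}\Big(\frac1{\nu T\kappa_0^2}+1\Big)^{\frac1{d+1}} .$$ In particular $\Lambda_u$ is finite almost everywhere on $[t,t+T]$. If $f$ does not depend on time, the last inequality holds for both expressions for $G$. -/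

import Mathlib

open MeasureTheory Set
open scoped ENNReal NNReal ContDiff

noncomputable section

namespace NSE

/-! ### The torus `[0,L]³`: periodic functions on `ℝ³` and Fourier coefficients -/

/-- Physical space and the space of velocities, with the Euclidean norm. -/
abbrev E3 := EuclideanSpace ℝ (Fin 3)

/-- The space of Fourier coefficients of vector fields. -/
abbrev C3 := EuclideanSpace ℂ (Fin 3)

/-- Frequencies `k ∈ ℤ³`. -/
abbrev Freq := Fin 3 → ℤ

/-- A frequency `k ∈ ℤ³`, seen as a vector of `ℝ³`. -/
def freqVec (k : Freq) : E3 := WithLp.toLp 2 (fun i => (k i : ℝ))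

/-- The fundamental cell `[0,L)³` of the torus of size `L`. -/
def cell (L : ℝ) : Set E3 := {x | ∀ i, x i ∈ Ico 0 L}

/-- Lebesgue measure on the torus of size `L` (total mass `L³`). -/
def torusMeasure (L : ℝ) : Measure E3 := volume.restrict (cell L)

/-- `L`-periodicity in each coordinate. -/
def IsPeriodic {α : Type*} (L : ℝ) (v : E3 → α) : Prop :=
  ∀ (x : E3) (k : Freq), v (x + L • freqVec k) = v x

/-- The phase `(2π/L) k · x`. -/
def phase (L : ℝ) (k : Freq) (x : E3) : ℝ := 2 * Real.pi / L * inner ℝ (freqVec k) x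

/-- The Fourier coefficients `v̂(k) = L⁻³ ∫ v(x) exp(-i (2π/L) k · x) dx`. -/
def fourierCoeff (L : ℝ) (v : E3 → E3) (k : Freq) : C3 :=
  WithLp.toLp 2 (fun j => ((L ^ 3 : ℝ) : ℂ)⁻¹ *
    ∫ x, ((v x j : ℝ) : ℂ) * Complex.exp (-(phase L k x : ℂ) * Complex.I) ∂(torusMeasure L))

/-- `‖v‖_{L²}²` on the torus, for `v ∈ L²`. -/
def normSq (L : ℝ) (v : E3 → E3) : ℝ := ∫ x, ‖v x‖ ^ 2 ∂(torusMeasure L)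

/-- `‖∇v‖_{L²}² = L³ ∑ₖ |2πk/L|² |v̂(k)|²`, for `v ∈ L²`; it is finite iff `v ∈ H¹`. -/
def gradNormSq (L : ℝ) (v : E3 → E3) : ℝ≥0∞ :=
  ∑' k : Freq, ENNReal.ofReal
    (L ^ 3 * (2 * Real.pi / L * ‖freqVec k‖) ^ 2 * ‖fourierCoeff L v k‖ ^ 2)

/-- The pairing `(g, v)` of a (real) distribution `g` on the torus, given by its Fourier
coefficients, with a vector field `v`; for `g ∈ L²` it is the `L²` inner product. -/
def pairing (L : ℝ) (g : Freq → C3) (v : E3 → E3) : ℝ :=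
  L ^ 3 * ∑' k : Freq, (inner ℂ (fourierCoeff L v k) (g k) : ℂ).re

/-! ### Littlewood-Paley decomposition -/

/-- The dyadic wavenumber `λ_q = 2^q / L`. -/
def lam (L : ℝ) (q : ℤ) : ℝ := (2 : ℝ) ^ q / L

/-- The admissible cut-off functions `χ` for the Littlewood-Paley decomposition. -/
structure IsCutoff (χ : E3 → ℝ) : Prop where
  smooth : ContDiff ℝ ∞ χ
  nonneg : ∀ ξ, 0 ≤ χ ξ
  radial : ∀ ξ η, ‖ξ‖ = ‖η‖ → χ ξ = χ η
  eq_one : ∀ ξ, ‖ξ‖ ≤ 3 / 4 → χ ξ = 1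
  eq_zero : ∀ ξ, 1 ≤ ‖ξ‖ → χ ξ = 0

/-- The symbols `φ_q`: `φ_q(ξ) = χ(2^{-q}ξ/2) - χ(2^{-q}ξ)` for `q ≥ 0`, and `φ_{-1} = χ`. -/
def lpSymbol (χ : E3 → ℝ) (q : ℤ) (ξ : E3) : ℝ :=
  if 0 ≤ q then χ ((2 : ℝ) ^ (-(q + 1)) • ξ) - χ ((2 : ℝ) ^ (-q) • ξ)
  else if q = -1 then χ ξ else 0

/-- The Littlewood-Paley projection `Δ_q` of the distribution with Fourier coefficients `a`
(a finite sum, since `φ_q` has compact support). -/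
def lpBlock (χ : E3 → ℝ) (L : ℝ) (a : Freq → C3) (q : ℤ) (x : E3) : C3 :=
  ∑' k : Freq, ((lpSymbol χ q (freqVec k) : ℂ) * Complex.exp ((phase L k x : ℂ) * Complex.I)) • a k

/-- The low modes `∑_{-1 ≤ q ≤ Q} Δ_q`. -/
def lpLow (χ : E3 → ℝ) (L : ℝ) (a : Freq → C3) (Q : ℤ) (x : E3) : C3 :=
  ∑ q ∈ Finset.Icc (-1) Q, lpBlock χ L a q x

/-- `‖Δ_q‖_{L^r}` on the torus. -/
def blockNorm (χ : E3 → ℝ) (L : ℝ) (r : ℝ≥0∞) (a : Freq → C3) (q : ℤ) : ℝ≥0∞ :=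
  eLpNorm (lpBlock χ L a q) r (torusMeasure L)

/-- The Euclidean (Frobenius) norm of the gradient of `w` at `x`. -/
def gradAbs (w : E3 → C3) (x : E3) : ℝ :=
  Real.sqrt (∑ i : Fin 3, ‖fderiv ℝ w x (EuclideanSpace.single i 1)‖ ^ 2)

/-- The Sobolev norm `‖·‖_{H^s} = (∑_{q ≥ -1} λ_q^{2s} ‖Δ_q ·‖_{L²}²)^{1/2}` of the distribution
with Fourier coefficients `a`; the summation index is `n = q + 1`. -/
def sobolevNorm (χ : E3 → ℝ) (L s : ℝ) (a : Freq → C3) : ℝ≥0∞ :=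
  (∑' n : ℕ, ENNReal.ofReal (lam L (n - 1) ^ (2 * s)) * blockNorm χ L 2 a (n - 1) ^ 2) ^ (1 / 2 : ℝ)

/-- `C_B` is a constant in Bernstein's inequality
`λ_q⁻¹ ‖v_q‖_{L^∞}² ≤ C_B λ_q² ‖v_q‖_{L²}²`, on the tori of all sizes. -/
def IsBernsteinConstant (χ : E3 → ℝ) (CB : ℝ) : Prop :=
  ∀ L : ℝ, 0 < L → ∀ v : E3 → E3, IsPeriodic L v → MemLp v 2 (torusMeasure L) → ∀ q : ℕ,
    ENNReal.ofReal ((lam L q)⁻¹) * blockNorm χ L ⊤ (fourierCoeff L v) q ^ 2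
      ≤ ENNReal.ofReal (CB * lam L q ^ 2) * blockNorm χ L 2 (fourierCoeff L v) q ^ 2

/-! ### Leray-Hopf solutions of the Navier-Stokes equations -/

/-- The standing assumptions on the force: `f(t)` is a real distribution with zero mean, given by
its Fourier coefficients, and `f` is translationally bounded in `L²_loc(ℝ; H⁻¹)`. -/
structure IsForce (χ : E3 → ℝ) (L : ℝ) (f : ℝ → Freq → C3) : Prop where
  measurable : ∀ k, AEStronglyMeasurable (fun t => f t k) volume
  real : ∀ t k j, f t (-k) j = (starRingEnd ℂ) (f t k j)
  zero_mean : ∀ t, f t 0 = 0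
  bounded : (⨆ t : ℝ, ∫⁻ τ in Icc t (t + 1), sobolevNorm χ L (-1) (f τ) ^ 2) < ⊤

/-- Smooth test fields on `(0,∞) × 𝕋³`, compactly supported in time and divergence free. -/
structure IsTestField (L : ℝ) (φ : ℝ → E3 → E3) : Prop where
  smooth : ContDiff ℝ ∞ (fun z : ℝ × E3 => φ z.1 z.2)
  periodic : ∀ t, IsPeriodic L (φ t)
  compact_support : ∃ a b : ℝ, 0 < a ∧ ∀ t, t ∉ Icc a b → φ t = 0
  div_free : ∀ t x, ∑ i : Fin 3, fderiv ℝ (φ t) x (EuclideanSpace.single i 1) i = 0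

/-- Weak solutions on `[0,∞)` of
`u_t + (u · ∇)u - νΔu + ∇p = f`, `∇ · u = 0`, with zero mean. The pressure is eliminated by
testing with divergence free fields. -/
structure IsWeakSolution (ν L : ℝ) (f : ℝ → Freq → C3) (u : ℝ → E3 → E3) : Prop where
  periodic : ∀ t, 0 ≤ t → IsPeriodic L (u t)
  memLp : ∀ t, 0 ≤ t → MemLp (u t) 2 (torusMeasure L)
  zero_mean : ∀ t, 0 ≤ t → ∫ x, u t x ∂(torusMeasure L) = 0
  weakly_continuous : ∀ g : E3 → E3, MemLp g 2 (torusMeasure L) →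
    ContinuousOn (fun t => ∫ x, inner ℝ (u t x) (g x) ∂(torusMeasure L)) (Ici 0)
  locally_H1 : ∀ a b : ℝ, 0 < a → (∫⁻ τ in Icc a b, gradNormSq L (u τ)) < ⊤
  div_free : ∀ t, 0 ≤ t → ∀ ψ : E3 → ℝ, ContDiff ℝ ∞ ψ → IsPeriodic L ψ →
    ∫ x, fderiv ℝ ψ x (u t x) ∂(torusMeasure L) = 0
  momentum : ∀ φ : ℝ → E3 → E3, IsTestField L φ →
    ∫ t : ℝ, ((∫ x, (inner ℝ (u t x) (deriv (fun s => φ s x) t)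
        + inner ℝ (u t x) (fderiv ℝ (φ t) x (u t x))
        + ν * inner ℝ (u t x) (Laplacian.laplacian (φ t) x)) ∂(torusMeasure L))
      + pairing L (f t) (φ t)) = 0

/-- Leray-Hopf solutions on `[0,∞)`: weak solutions that satisfy the energy inequality from almost
every initial time. -/
structure IsLerayHopf (ν L : ℝ) (f : ℝ → Freq → C3) (u : ℝ → E3 → E3) : Prop extends
    IsWeakSolution ν L f u where
  energy : ∀ᵐ t₀ : ℝ, 0 < t₀ → ∀ t, t₀ < t →
    normSq L (u t) / 2 ≤ normSq L (u t₀) / 2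
      - ν * (∫ τ in t₀..t, (gradNormSq L (u τ)).toReal) + ∫ τ in t₀..t, pairing L (f τ) (u τ)

/-- Complete Leray-Hopf solutions: all time translates restrict to Leray-Hopf solutions on
`[0,∞)` (with the translated force). -/
def IsCompleteLerayHopf (ν L : ℝ) (f : ℝ → Freq → C3) (u : ℝ → E3 → E3) : Prop :=
  ∀ s : ℝ, IsLerayHopf ν L (fun τ => f (τ - s)) (fun τ => u (τ - s))

/-- Boundedness in `L²`, uniformly in time. -/
def IsBoundedL2 (L : ℝ) (u : ℝ → E3 → E3) : Prop :=
  ∃ M : ℝ≥0, ∀ t, eLpNorm (u t) 2 (torusMeasure L) ≤ M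

/-! ### Averages, wavenumbers, intermittency dimension, Grashof number -/

/-- The time average `(1/T) ∫_t^{t+T} g` of a function with values in `[0,∞]`. -/
def timeAvg (T : ℝ) (g : ℝ → ℝ≥0∞) (t : ℝ) : ℝ≥0∞ :=
  (ENNReal.ofReal T)⁻¹ * ∫⁻ τ in Icc t (t + T), g τ

/-- The two conditions on `λ_q` in the definition of the determining wavenumber:
`(L λ_{p-q})^{(δ-1)/2} λ_q⁻¹ ‖v_p‖_{L^∞} < c₀ ν` for all `p > q`, and
`λ_q⁻² ‖∇ v_{≤ q}‖_{L^∞} < c₀ ν`. -/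
def IsDetermining (χ : E3 → ℝ) (L ν c₀ δ : ℝ) (v : E3 → E3) (q : ℕ) : Prop :=
  (∀ p : ℕ, q < p →
    ENNReal.ofReal ((L * lam L ((p : ℤ) - q)) ^ ((δ - 1) / 2) * (lam L q)⁻¹)
      * blockNorm χ L ⊤ (fourierCoeff L v) p < ENNReal.ofReal (c₀ * ν)) ∧
  ENNReal.ofReal ((lam L q ^ 2)⁻¹)
      * eLpNorm (gradAbs (lpLow χ L (fourierCoeff L v) q)) ⊤ (torusMeasure L)
    < ENNReal.ofReal (c₀ * ν)

/-- The determining wavenumber `Λ_v = min {λ_q : q ∈ ℕ, q satisfies the two conditions}`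
(`∞` if there is no such `q`). -/
def detWavenumber (χ : E3 → ℝ) (L ν c₀ δ : ℝ) (v : E3 → E3) : ℝ≥0∞ :=
  sInf {Λ | ∃ q : ℕ, IsDetermining χ L ν c₀ δ v q ∧ Λ = ENNReal.ofReal (lam L q)}

open Classical in
/-- The intermittency dimension of `u` on `[t, t + T]`: the supremum of all real `s` with
`⟨∑_q λ_q^{-1+s} ‖u_q‖_{L^∞}²⟩ ≤ C_B^{3-s} λ_0^s ⟨∑_q λ_q² ‖u_q‖_{L²}²⟩`, and `3` if `u` vanishes
on `[t, t + T]`. The summation index is `n = q + 1`. -/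
def intermittencyDim (χ : E3 → ℝ) (CB L T : ℝ) (u : ℝ → E3 → E3) (t : ℝ) : ℝ :=
  if ∀ τ ∈ Icc t (t + T), u τ =ᵐ[torusMeasure L] 0 then 3
  else sSup {s : ℝ |
    timeAvg T (fun τ => ∑' n : ℕ, ENNReal.ofReal (lam L (n - 1) ^ (-1 + s))
        * blockNorm χ L ⊤ (fourierCoeff L (u τ)) (n - 1) ^ 2) t
      ≤ ENNReal.ofReal (CB ^ (3 - s) * lam L 0 ^ s)
        * timeAvg T (fun τ => ∑' n : ℕ, ENNReal.ofReal (lam L (n - 1) ^ 2)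
          * blockNorm χ L 2 (fourierCoeff L (u τ)) (n - 1) ^ 2) t}

/-- The average energy dissipation rate `ε = λ_0^d ν ⟨‖∇u‖_{L²}²⟩` per unit active volume. -/
def dissipationRate (L ν T d : ℝ) (u : ℝ → E3 → E3) (t : ℝ) : ℝ :=
  lam L 0 ^ d * ν * (timeAvg T (fun τ => gradNormSq L (u τ)) t).toReal

/-- Kolmogorov's dissipation wavenumber `κ_d = (ε / ν³)^{1/(d+1)}`. -/
def kolmogorovWavenumber (L ν T d : ℝ) (u : ℝ → E3 → E3) (t : ℝ) : ℝ :=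
  (dissipationRate L ν T d u t / ν ^ 3) ^ (1 / (d + 1))

/-- `κ_0 = 2π / L`. -/
def kappa0 (L : ℝ) : ℝ := 2 * Real.pi / L

/-- `‖f‖_{L²_b(T)} = (sup_t (1/T) ∫_t^{t+T} ‖f(τ)‖_{H⁻¹}² dτ)^{1/2}`. -/
def forceNorm (χ : E3 → ℝ) (L T : ℝ) (f : ℝ → Freq → C3) : ℝ :=
  Real.sqrt (⨆ t : ℝ, timeAvg T (fun τ => sobolevNorm χ L (-1) (f τ) ^ 2) t).toReal

/-- The Grashof number of a time-dependent force,
`G = T^{1/2} κ_0^{1/2} ‖f‖_{L²_b(T)} / (ν^{3/2} (1 - e^{-ν κ_0² T})^{1/2})`. -/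
def grashof (χ : E3 → ℝ) (L ν T : ℝ) (f : ℝ → Freq → C3) : ℝ :=
  T ^ (1 / 2 : ℝ) * kappa0 L ^ (1 / 2 : ℝ) * forceNorm χ L T f /
    (ν ^ (3 / 2 : ℝ) * (1 - Real.exp (-(ν * kappa0 L ^ 2 * T))) ^ (1 / 2 : ℝ))

/-- The Grashof number `G = ‖F‖_{H⁻¹} / (ν² κ_0^{1/2})` of a time-independent force `F`. -/
def grashofAutonomous (χ : E3 → ℝ) (L ν : ℝ) (F : Freq → C3) : ℝ :=
  (sobolevNorm χ L (-1) F).toReal / (ν ^ 2 * kappa0 L ^ (1 / 2 : ℝ))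

/-- The quantity `κ_0 G^{2/(d+1)} (1/(ν T κ_0²) + 1)^{1/(d+1)}`. -/
def grashofBound (L ν T d G : ℝ) : ℝ :=
  kappa0 L * G ^ (2 / (d + 1)) * (1 / (ν * T * kappa0 L ^ 2) + 1) ^ (1 / (d + 1))

end NSE

end

/-!
The proof has two independent halves.

**The determining wavenumber.** If `λ_q` does not satisfy the two conditions that define `Λ_u`, then
`λ_q^{d+1} (c₀ν)² ≲ ∑_p λ_p^{d-1} ‖u_p‖_∞²`, pointwise in time. When the condition on the high modes
fails, a single block on the right is large enough, because `δ ≤ d`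
(`lam_rpow_le_of_high`). When the condition on the low modes fails, Bernstein's inequality
`‖∇u_p‖_∞ ≲ λ_p ‖u_p‖_∞` and the Cauchy-Schwarz inequality give the same bound, because
`∑_{p ≤ q} λ_p^{3-d} ≲ λ_q^{3-d}` for `d < 3` (`IsCutoff.lam_rpow_le_of_low`). Applied to the last
`q` that fails, this bounds `Λ_u - λ_0` by a multiple of the `1/(d+1)`-th power of the square sum
(`IsCutoff.detWavenumber_le`); if every `q` fails, the square sum is infinite. Jensen's inequality
moves the power outside the time average, and the definition of the intermittency dimension, whose
supremum is attained (`supSquareSum_avg_le`), replaces the average of the square sum by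
`λ_0^d ⟨∑ λ_q² ‖u_q‖²⟩ ≲ λ_0^d ⟨‖∇u‖²⟩`.

Bernstein's inequality for the gradient in `L^∞` is obtained without kernels: along a coordinate
line a block is an exponential sum with frequencies in `[-N, N]`. By the Phragmén-Lindelöf principle
it is bounded by `e` times its supremum in the strip `|Im z| ≤ 1/N`, and Cauchy's estimate on discs
of radius `1/N` bounds its derivative (`norm_deriv_expSum_le`).

**The Grashof number.** Since Kolmogorov's wavenumber is a power of `λ_0^d ⟨‖∇u‖²⟩ / ν²`, the second
inequality is a bound of the mean dissipation. The energy inequality with Young's inequality reads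
`E(t) + ν ∫ ‖∇u‖² ≤ E(s) + ν⁻¹ ∫ ‖f‖²` for almost every `s` and all `t > s`. Together with
Poincaré's inequality and the boundedness of `u` it bounds the energy by the force alone
(`energy_le`), and then the dissipation (`dissipation_le`). No sharp Grönwall argument is needed:
the dyadic `H⁻¹` norm is built with `λ_q = 2^q/L` in place of `2π|k|/L`, so that its square exceeds
the square of the dual norm of `‖∇·‖_{L²}` by a factor of at least `10`
(`IsCutoff.ten_mul_dualNormSq_le`), which absorbs all constants.
-/

noncomputable section

namespace NSE

/-! ### Bernstein's inequality for exponential sums -/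

section Bernstein

variable {ι E : Type*} [NormedAddCommGroup E] [NormedSpace ℂ E]

/-- The exponential sum `∑ e^{iθ_k z} a_k`, as an entire function. -/
def expSum (s : Finset ι) (θ : ι → ℝ) (a : ι → E) (z : ℂ) : E :=
  ∑ k ∈ s, Complex.exp (Complex.I * θ k * z) • a k

lemma differentiable_expSum (s : Finset ι) (θ : ι → ℝ) (a : ι → E) :
    Differentiable ℂ (expSum s θ a) := by
  unfold expSum
  fun_prop

lemma deriv_expSum_zero (s : Finset ι) (θ : ι → ℝ) (a : ι → E) :
    deriv (expSum s θ a) 0 = ∑ k ∈ s, (Complex.I * θ k) • a k := by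
  have h : HasDerivAt (expSum s θ a)
      (∑ k ∈ s, (Complex.exp (Complex.I * θ k * 0) * (Complex.I * θ k)) • a k) 0 := by
    unfold expSum
    refine HasDerivAt.fun_sum fun k _ => ?_
    have := (((hasDerivAt_id (0 : ℂ)).const_mul (Complex.I * θ k)).cexp).smul_const (a k)
    simpa using this
  rw [h.deriv]
  simp

/-- An exponential sum with frequencies `≥ 0`, bounded by `B` on the real line, is bounded by `B`
in the upper half plane: this is the Phragmén-Lindelöf principle. -/
lemma norm_expSum_le_of_nonneg {s : Finset ι} {θ : ι → ℝ} {a : ι → E} {B : ℝ}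
    (hθ : ∀ k ∈ s, 0 ≤ θ k) (hB : ∀ x : ℝ, ‖expSum s θ a x‖ ≤ B) {z : ℂ} (hz : 0 ≤ z.im) :
    ‖expSum s θ a z‖ ≤ B := by
  -- the multiplication by `i` turns the right half plane into the upper half plane
  have hbd : ∀ w : ℂ, 0 ≤ w.re → ‖expSum s θ a (Complex.I * w)‖ ≤ ∑ k ∈ s, ‖a k‖ := by
    intro w hw
    refine (norm_sum_le _ _).trans (Finset.sum_le_sum fun k hk => ?_)
    rw [norm_smul, Complex.norm_exp]
    have : (Complex.I * θ k * (Complex.I * w)).re = -(θ k * w.re) := by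
      have : Complex.I * θ k * (Complex.I * w) = -(θ k * w) := by
        linear_combination (θ k * w) * Complex.I_mul_I
      rw [this]; simp
    rw [this]
    exact mul_le_of_le_one_left (norm_nonneg _)
      (Real.exp_le_one_iff.2 (neg_nonpos.2 (mul_nonneg (hθ k hk) hw)))
  have key : ‖expSum s θ a (Complex.I * (-Complex.I * z))‖ ≤ B := by
    refine PhragmenLindelof.right_half_plane_of_bounded_on_real
      (f := fun w => expSum s θ a (Complex.I * w)) ?_ ⟨0, by norm_num, 0, ?_⟩ ?_ ?_ ?_
    · exact ((differentiable_expSum s θ a).comp (by fun_prop)).diffContOnCl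
    · refine Asymptotics.IsBigO.of_bound (∑ k ∈ s, ‖a k‖) ?_
      refine Filter.Eventually.filter_mono inf_le_right (Filter.eventually_principal.2 ?_)
      intro w hw
      simpa using hbd w (le_of_lt hw)
    · refine ⟨∑ k ∈ s, ‖a k‖, ?_⟩
      simp only [Filter.eventually_map]
      filter_upwards [Filter.eventually_ge_atTop 0] with x hx
      exact hbd x (by simpa using hx)
    · intro x
      have := hB (-x)
      have e : Complex.I * (x * Complex.I) = ((-x : ℝ) : ℂ) := by
        push_cast
        linear_combination (x : ℂ) * Complex.I_mul_I
      rwa [e]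
    · simpa using hz
  have e : Complex.I * (-Complex.I * z) = z := by linear_combination -z * Complex.I_mul_I
  rwa [e] at key

lemma expSum_shift (s : Finset ι) (θ : ι → ℝ) (a : ι → E) (N : ℝ) (z : ℂ) :
    expSum s (fun k => θ k + N) a z = Complex.exp (Complex.I * N * z) • expSum s θ a z := by
  simp only [expSum, Finset.smul_sum, smul_smul, ← Complex.exp_add]
  refine Finset.sum_congr rfl fun k _ => ?_
  congr 2
  push_cast
  ring

lemma expSum_neg (s : Finset ι) (θ : ι → ℝ) (a : ι → E) (z : ℂ) :
    expSum s (fun k => -θ k) a z = expSum s θ a (-z) := by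
  simp only [expSum]
  refine Finset.sum_congr rfl fun k _ => ?_
  congr 2
  push_cast
  ring

lemma norm_exp_I_mul (N x : ℝ) : ‖Complex.exp (Complex.I * N * x)‖ = 1 := by
  rw [Complex.norm_exp]
  simp

/-- The shift by `N` makes all frequencies nonnegative and costs the factor `e^{N Im z}`. -/
lemma norm_expSum_le_of_im_nonneg {s : Finset ι} {θ : ι → ℝ} {a : ι → E} {N B : ℝ}
    (hθ : ∀ k ∈ s, |θ k| ≤ N) (hB : ∀ x : ℝ, ‖expSum s θ a x‖ ≤ B) {z : ℂ} (hz : 0 ≤ z.im) :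
    ‖expSum s θ a z‖ ≤ Real.exp (N * z.im) * B := by
  have h := norm_expSum_le_of_nonneg (s := s) (θ := fun k => θ k + N) (a := a) (B := B)
    (fun k hk => by linarith [neg_le_of_abs_le (hθ k hk)])
    (fun x => by rw [expSum_shift, norm_smul, norm_exp_I_mul, one_mul]; exact hB x) hz
  rw [expSum_shift, norm_smul, Complex.norm_exp] at h
  have e : (Complex.I * N * z).re = -(N * z.im) := by simp
  rw [e, Real.exp_neg] at h
  exact (inv_mul_le_iff₀ (Real.exp_pos _)).1 h

/-- An exponential sum with frequencies in `[-N, N]`, bounded by `B` on the real line, grows at most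
like `e^{N |Im z|} B`. -/
lemma norm_expSum_le {s : Finset ι} {θ : ι → ℝ} {a : ι → E} {N B : ℝ}
    (hθ : ∀ k ∈ s, |θ k| ≤ N) (hB : ∀ x : ℝ, ‖expSum s θ a x‖ ≤ B) (z : ℂ) :
    ‖expSum s θ a z‖ ≤ Real.exp (N * |z.im|) * B := by
  rcases le_total 0 z.im with h | h
  · rw [abs_of_nonneg h]; exact norm_expSum_le_of_im_nonneg hθ hB h
  · have := norm_expSum_le_of_im_nonneg (s := s) (θ := fun k => -θ k) (a := a) (N := N) (B := B)
      (by simpa using hθ) (fun x => by rw [expSum_neg]; simpa using hB (-x)) (z := -z)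
      (by simpa using h)
    rw [expSum_neg, neg_neg] at this
    simpa [abs_of_nonpos h] using this

/-- **Bernstein's inequality**, with the constant `e` in place of `1`: the derivative of an
exponential sum with frequencies in `[-N, N]` is bounded by `e N` times its supremum. -/
theorem norm_deriv_expSum_le {s : Finset ι} {θ : ι → ℝ} {a : ι → E} {N B : ℝ} (hN : 0 < N)
    (hθ : ∀ k ∈ s, |θ k| ≤ N) (hB : ∀ x : ℝ, ‖expSum s θ a x‖ ≤ B) :
    ‖∑ k ∈ s, (Complex.I * θ k) • a k‖ ≤ Real.exp 1 * N * B := by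
  have hB0 : 0 ≤ B := (norm_nonneg _).trans (hB 0)
  rw [← deriv_expSum_zero]
  have := Complex.norm_deriv_le_of_forall_mem_sphere_norm_le (c := 0) (R := N⁻¹)
    (C := Real.exp 1 * B) (f := expSum s θ a) (inv_pos.2 hN)
    (differentiable_expSum s θ a).diffContOnCl (fun z hz => by
      refine (norm_expSum_le hθ hB z).trans ?_
      gcongr
      have h1 : |z.im| ≤ N⁻¹ := by
        rw [mem_sphere_zero_iff_norm] at hz
        exact hz ▸ Complex.abs_im_le_norm z
      calc N * |z.im| ≤ N * N⁻¹ := by gcongr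
        _ = 1 := mul_inv_cancel₀ hN.ne')
  refine this.trans (le_of_eq ?_)
  field_simp

end Bernstein

/-! ### Fourier series on the torus of size `L` -/

/-- The invariant probability measure on `(ℝ/ℤ)³`. -/
def haarTorus : Measure (UnitAddTorus (Fin 3)) := Measure.pi fun _ => AddCircle.haarAddCircle

/-- The section of `ℝ³ → (ℝ/Lℤ)³ ≃ (ℝ/ℤ)³` with values in `(0,L]³`. -/
def torusSection (L : ℝ) (y : UnitAddTorus (Fin 3)) : E3 :=
  L • WithLp.toLp 2 (UnitAddTorus.measurableEquivPiIoc (0 : Fin 3 → ℝ) y).1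

lemma freqVec_apply (k : Freq) (i : Fin 3) : freqVec k i = k i := rfl

lemma phase_eq (L : ℝ) (k : Freq) (x : E3) :
    phase L k x = 2 * Real.pi / L * ∑ i, (k i : ℝ) * x i := by
  simp [phase, PiLp.inner_apply, freqVec_apply, mul_comm]

/-- Pulled back to `(ℝ/ℤ)³`, the exponentials of the torus of size `L` are the standard ones. -/
lemma exp_phase_torusSection {L : ℝ} (hL : 0 < L) (k : Freq) (y : UnitAddTorus (Fin 3)) :
    Complex.exp ((phase L k (torusSection L y) : ℂ) * Complex.I) = UnitAddTorus.mFourier k y := by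
  have hy : ∀ i,
      ((UnitAddTorus.measurableEquivPiIoc (0 : Fin 3 → ℝ) y).1 i : UnitAddCircle) = y i :=
    fun i => congrFun ((UnitAddTorus.measurableEquivPiIoc (0 : Fin 3 → ℝ)).symm_apply_apply y) i
  have : UnitAddTorus.mFourier k y = ∏ i, fourier (k i) (y i) := rfl
  rw [this]
  simp_rw [← hy, fourier_coe_apply, ← Complex.exp_sum]
  congr 1
  rw [phase_eq]
  simp only [torusSection, PiLp.smul_apply, smul_eq_mul]
  push_cast
  rw [Finset.mul_sum, Finset.sum_mul]
  refine Finset.sum_congr rfl fun i _ => ?_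
  have : (L : ℂ) ≠ 0 := by exact_mod_cast hL.ne'
  field_simp

lemma measurableSet_cell (L : ℝ) : MeasurableSet (cell L) := by
  have : cell L = ⋂ i, {x : E3 | x i ∈ Ico 0 L} := by ext; simp [cell]
  rw [this]
  refine MeasurableSet.iInter fun i => ?_
  exact measurableSet_Ico.preimage (by fun_prop : Measurable fun x : E3 => x i)

lemma cell_ae_eq_Ioc (L : ℝ) :
    (cell L : Set E3) =ᵐ[volume] {x : E3 | ∀ i, x i ∈ Ioc 0 L} := by
  have h1 := (Measure.univ_pi_Ico_ae_eq_Icc (μ := fun _ : Fin 3 => (volume : Measure ℝ))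
    (f := 0) (g := fun _ => L))
  have h2 := (Measure.univ_pi_Ioc_ae_eq_Icc (μ := fun _ : Fin 3 => (volume : Measure ℝ))
    (f := 0) (g := fun _ => L))
  have h := (PiLp.volume_preserving_ofLp (Fin 3)).quasiMeasurePreserving.preimage_ae_eq
    (h1.trans h2.symm)
  have e1 : cell L = (@WithLp.ofLp 2 (Fin 3 → ℝ)) ⁻¹' (Set.pi univ fun _ => Ico 0 L) := by
    ext; simp [cell]
  have e2 : {x : E3 | ∀ i, x i ∈ Ioc 0 L}
      = (@WithLp.ofLp 2 (Fin 3 → ℝ)) ⁻¹' (Set.pi univ fun _ => Ioc 0 L) := by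
    ext; simp
  rw [e1, e2]
  exact h

/-- Up to the total mass `L³`, integration over the fundamental cell is integration over `(ℝ/ℤ)³`;
this carries Mathlib's Fourier analysis over to the torus of size `L`. -/
lemma measurePreserving_torusSection {L : ℝ} (hL : 0 < L) :
    MeasurePreserving (torusSection L) (ENNReal.ofReal (L ^ 3) • haarTorus) (torusMeasure L) := by
  set I : Set (Fin 3 → ℝ) :=
    {x | ∀ i, x i ∈ Ioc ((0 : Fin 3 → ℝ) i) ((0 : Fin 3 → ℝ) i + 1)} with hI
  have hIm : MeasurableSet I := MeasurableSet.univ_pi' fun i => measurableSet_Ioc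
  have h1 : MeasurePreserving (UnitAddTorus.measurableEquivPiIoc (0 : Fin 3 → ℝ)) haarTorus
    (Measure.comap Subtype.val volume) := UnitAddTorus.measurePreserving_equivPiIoc 0
  have h2 : MeasurePreserving (Subtype.val : I → _) (Measure.comap Subtype.val volume)
      (volume.restrict I) := ⟨measurable_subtype_coe, map_comap_subtype_coe hIm volume⟩
  have hm : ∀ c : ℝ, MeasurableSet {x : E3 | ∀ i, x i ∈ Ioc 0 c} := fun c => by
    have : {x : E3 | ∀ i, x i ∈ Ioc 0 c} = ⋂ i, {x : E3 | x i ∈ Ioc 0 c} := by ext; simp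
    rw [this]
    exact MeasurableSet.iInter fun i =>
      measurableSet_Ioc.preimage (by fun_prop : Measurable fun x : E3 => x i)
  have h3 := (PiLp.volume_preserving_toLp (Fin 3)).restrict_preimage (hm 1)
  have h4 : MeasurePreserving (fun x : E3 => L • x) (ENNReal.ofReal (L ^ 3) • volume) volume := by
    refine ⟨by fun_prop, ?_⟩
    rw [Measure.map_smul, Measure.map_addHaar_smul volume hL.ne', smul_smul]
    have : Module.finrank ℝ E3 = 3 := by simp
    rw [this, abs_of_pos (by positivity), ← ENNReal.ofReal_mul (by positivity),
      mul_inv_cancel₀ (by positivity)]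
    simp
  have h5 := h4.restrict_preimage (hm L)
  have e5 : (fun x : E3 => L • x) ⁻¹' {x | ∀ i, x i ∈ Ioc 0 L} = {x : E3 | ∀ i, x i ∈ Ioc 0 1} := by
    ext x
    simp [hL]
  rw [e5, Measure.restrict_smul, ← Measure.restrict_congr_set (cell_ae_eq_Ioc L)] at h5
  have e3 : (@WithLp.toLp 2 (Fin 3 → ℝ)) ⁻¹' {x : E3 | ∀ i, x i ∈ Ioc 0 1} = I := by
    ext x; simp [hI]
  rw [e3] at h3
  have h6 := (h3.comp (h2.comp h1)).smul_measure (ENNReal.ofReal (L ^ 3))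
  exact h5.comp h6

instance : IsProbabilityMeasure haarTorus := by
  unfold haarTorus; infer_instance

lemma integral_torusMeasure {F : Type*} [NormedAddCommGroup F] [NormedSpace ℝ F] {L : ℝ}
    (hL : 0 < L) {g : E3 → F} (hg : AEStronglyMeasurable g (torusMeasure L)) :
    ∫ x, g x ∂(torusMeasure L) = L ^ 3 • ∫ y, g (torusSection L y) ∂haarTorus := by
  have h := measurePreserving_torusSection hL
  rw [← h.map_eq] at hg ⊢
  rw [integral_map h.measurable.aemeasurable hg, integral_smul_measure,
    ENNReal.toReal_ofReal (by positivity)]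

lemma memLp_comp_torusSection {F : Type*} [NormedAddCommGroup F] {L : ℝ}
    (hL : 0 < L) {p : ℝ≥0∞} {g : E3 → F} (hg : MemLp g p (torusMeasure L)) :
    MemLp (fun y => g (torusSection L y)) p haarTorus := by
  have h := hg.comp_measurePreserving (measurePreserving_torusSection hL)
  have h2 := h.smul_measure (c := (ENNReal.ofReal (L ^ 3))⁻¹)
    (by simp only [ne_eq, ENNReal.inv_eq_top, ENNReal.ofReal_eq_zero, not_le]; positivity)
  rw [smul_smul, ENNReal.inv_mul_cancel
    (by simp only [ne_eq, ENNReal.ofReal_eq_zero, not_le]; positivity)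
    ENNReal.ofReal_ne_top, one_smul] at h2
  exact h2

lemma integral_mFourier (k : Freq) :
    ∫ y, UnitAddTorus.mFourier k y ∂haarTorus = if k = 0 then 1 else 0 := by
  have h := (orthonormal_iff_ite.1 (UnitAddTorus.orthonormal_mFourier (d := Fin 3))) 0 k
  rw [ContinuousMap.inner_toLp] at h
  simp only [UnitAddTorus.mFourier_zero, ContinuousMap.one_apply, map_one, mul_one] at h
  refine Eq.trans ?_ (h.trans ?_)
  · rfl
  · simp [eq_comm]

lemma hasSum_sq_haarTorus {g : UnitAddTorus (Fin 3) → ℂ} (hg : MemLp g 2 haarTorus) :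
    HasSum (fun k : Freq => ‖∫ y, UnitAddTorus.mFourier (-k) y * g y ∂haarTorus‖ ^ 2)
      (∫ y, ‖g y‖ ^ 2 ∂haarTorus) := by
  have hP : HasSum
      (fun k : Freq => ‖∫ y, UnitAddTorus.mFourier (-k) y * hg.toLp g y ∂haarTorus‖ ^ 2)
      (∫ y, ‖hg.toLp g y‖ ^ 2 ∂haarTorus) :=
    UnitAddTorus.hasSum_sq_mFourierCoeff (d := Fin 3) (hg.toLp g)
  have e1 : ∀ k : Freq, ∫ y, UnitAddTorus.mFourier (-k) y * hg.toLp g y ∂haarTorus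
      = ∫ y, UnitAddTorus.mFourier (-k) y * g y ∂haarTorus := fun k => by
    refine integral_congr_ae ?_
    filter_upwards [hg.coeFn_toLp] with y hy
    rw [hy]
  have e2 : ∫ y, ‖hg.toLp g y‖ ^ 2 ∂haarTorus = ∫ y, ‖g y‖ ^ 2 ∂haarTorus := by
    refine integral_congr_ae ?_
    filter_upwards [hg.coeFn_toLp] with y hy
    rw [hy]
  simpa only [e1, e2] using hP

/-- **Parseval's identity** for scalar functions on the torus of size `L`. -/
lemma hasSum_sq_integral_exp {L : ℝ} (hL : 0 < L) {g : E3 → ℂ} (hg : MemLp g 2 (torusMeasure L)) :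
    HasSum (fun k : Freq => L ^ 3 * ‖((L ^ 3 : ℝ) : ℂ)⁻¹ *
      ∫ x, g x * Complex.exp (-(phase L k x : ℂ) * Complex.I) ∂(torusMeasure L)‖ ^ 2)
      (∫ x, ‖g x‖ ^ 2 ∂(torusMeasure L)) := by
  rw [integral_torusMeasure hL (g := fun x => ‖g x‖ ^ 2) (hg.1.norm.pow 2), smul_eq_mul]
  refine HasSum.mul_left _ ?_
  have e : ∀ k : Freq, ((L ^ 3 : ℝ) : ℂ)⁻¹ *
      ∫ x, g x * Complex.exp (-(phase L k x : ℂ) * Complex.I) ∂(torusMeasure L)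
      = ∫ y, UnitAddTorus.mFourier (-k) y * g (torusSection L y) ∂haarTorus := fun k => by
    rw [integral_torusMeasure hL]
    · rw [Complex.real_smul, inv_mul_cancel_left₀ (by exact_mod_cast (by positivity))]
      refine integral_congr_ae (.of_forall fun y => ?_)
      simp only
      rw [UnitAddTorus.mFourier_neg, ← exp_phase_torusSection hL, ← Complex.exp_conj, mul_comm]
      simp
    · refine hg.1.mul (Continuous.aestronglyMeasurable ?_)
      unfold phase
      fun_prop
  simpa only [e] using hasSum_sq_haarTorus (memLp_comp_torusSection hL hg)

/-- **Parseval's identity** for vector fields on the torus of size `L`. -/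
theorem hasSum_sq_fourierCoeff {L : ℝ} (hL : 0 < L) {v : E3 → E3}
    (hv : MemLp v 2 (torusMeasure L)) :
    HasSum (fun k : Freq => L ^ 3 * ‖fourierCoeff L v k‖ ^ 2) (normSq L v) := by
  have hj : ∀ j : Fin 3, MemLp (fun x => ((v x j : ℝ) : ℂ)) 2 (torusMeasure L) := fun j => by
    have : MemLp (fun x => v x j) 2 (torusMeasure L) :=
      (EuclideanSpace.proj (𝕜 := ℝ) j : E3 →L[ℝ] ℝ).comp_memLp' hv
    exact this.ofReal
  have h := hasSum_sum (s := Finset.univ) fun j _ => hasSum_sq_integral_exp hL (hj j)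
  have e : normSq L v = ∑ j, ∫ x, ‖((v x j : ℝ) : ℂ)‖ ^ 2 ∂(torusMeasure L) := by
    rw [← integral_finsetSum _ fun j _ => (hj j).integrable_norm_pow (by norm_num)]
    unfold normSq
    simp [EuclideanSpace.norm_sq_eq]
  rw [e]
  convert h using 2 with k
  simp [fourierCoeff, EuclideanSpace.norm_sq_eq, Finset.mul_sum]

/-- **Parseval's identity** for trigonometric polynomials. -/
lemma integral_norm_sq_trigPoly {L : ℝ} (hL : 0 < L) (s : Finset Freq) (c : Freq → C3) :
    ∫ x, ‖∑ k ∈ s, Complex.exp ((phase L k x : ℂ) * Complex.I) • c k‖ ^ 2 ∂(torusMeasure L)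
      = L ^ 3 * ∑ k ∈ s, ‖c k‖ ^ 2 := by
  rw [integral_torusMeasure hL, smul_eq_mul]
  swap
  · refine Continuous.aestronglyMeasurable ?_
    unfold phase
    fun_prop
  congr 1
  simp_rw [exp_phase_torusSection hL]
  have e : ∀ y, ((‖∑ k ∈ s, UnitAddTorus.mFourier k y • c k‖ ^ 2 : ℝ) : ℂ)
      = ∑ k ∈ s, ∑ m ∈ s, UnitAddTorus.mFourier (m - k) y * inner ℂ (c k) (c m) := by
    intro y
    have := inner_self_eq_norm_sq_to_K (𝕜 := ℂ) (∑ k ∈ s, UnitAddTorus.mFourier k y • c k)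
    push_cast
    refine Eq.trans this.symm ?_
    rw [sum_inner]
    refine Finset.sum_congr rfl fun k _ => ?_
    rw [inner_sum]
    refine Finset.sum_congr rfl fun m _ => ?_
    rw [inner_smul_left, inner_smul_right, ← mul_assoc, ← UnitAddTorus.mFourier_neg,
      ← UnitAddTorus.mFourier_add, neg_add_eq_sub]
  have hint : ∀ k : Freq, Integrable (fun y => UnitAddTorus.mFourier k y) haarTorus := fun k =>
    (map_continuous (UnitAddTorus.mFourier k)).integrable_of_hasCompactSupport
      (HasCompactSupport.of_compactSpace _)
  apply Complex.ofReal_injective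
  rw [← integral_complex_ofReal]
  simp_rw [e]
  rw [integral_finsetSum _ fun k _ => integrable_finsetSum _ fun m _ => (hint _).mul_const _]
  push_cast
  refine Finset.sum_congr rfl fun k hk => ?_
  rw [integral_finsetSum _ fun m _ => (hint _).mul_const _]
  simp_rw [integral_mul_const, integral_mFourier, sub_eq_zero, ite_mul, zero_mul, one_mul]
  rw [Finset.sum_ite_eq' s k, if_pos hk]
  simp

/-! ### Symbols and blocks of the Littlewood-Paley decomposition -/

lemma lam_pos {L : ℝ} (hL : 0 < L) (q : ℤ) : 0 < lam L q := by
  unfold lam; positivity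

lemma IsCutoff.exists_bound {χ : E3 → ℝ} (hχ : IsCutoff χ) : ∃ M : ℝ, 0 < M ∧ ∀ ξ, χ ξ ≤ M := by
  obtain ⟨M, hM⟩ :=
    (isCompact_closedBall (0 : E3) 1).bddAbove_image hχ.smooth.continuous.continuousOn
  refine ⟨max M 1, by positivity, fun ξ => ?_⟩
  rcases le_total ‖ξ‖ 1 with h | h
  · exact le_max_of_le_left (hM ⟨ξ, by simpa using h, rfl⟩)
  · rw [hχ.eq_zero ξ h]; positivity

lemma lpSymbol_of_nonneg {χ : E3 → ℝ} {q : ℤ} (hq : 0 ≤ q) (ξ : E3) :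
    lpSymbol χ q ξ = χ ((2 : ℝ) ^ (-(q + 1)) • ξ) - χ ((2 : ℝ) ^ (-q) • ξ) := if_pos hq

lemma norm_two_zpow_smul (q : ℤ) (ξ : E3) : ‖(2 : ℝ) ^ (-q) • ξ‖ = ‖ξ‖ / 2 ^ q := by
  rw [norm_smul, Real.norm_of_nonneg (by positivity), zpow_neg, div_eq_inv_mul]

lemma IsCutoff.two_zpow_smul_eq_zero {χ : E3 → ℝ} (hχ : IsCutoff χ) {q : ℤ} {ξ : E3}
    (h : (2 : ℝ) ^ q ≤ ‖ξ‖) : χ ((2 : ℝ) ^ (-q) • ξ) = 0 := by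
  refine hχ.eq_zero _ ?_
  rwa [norm_two_zpow_smul, le_div_iff₀ (by positivity), one_mul]

lemma IsCutoff.two_zpow_smul_eq_one {χ : E3 → ℝ} (hχ : IsCutoff χ) {q : ℤ} {ξ : E3}
    (h : ‖ξ‖ ≤ 3 / 4 * (2 : ℝ) ^ q) : χ ((2 : ℝ) ^ (-q) • ξ) = 1 := by
  refine hχ.eq_one _ ?_
  rwa [norm_two_zpow_smul, div_le_iff₀ (by positivity)]

lemma IsCutoff.lpSymbol_eq_zero_of_le {χ : E3 → ℝ} (hχ : IsCutoff χ) {q : ℤ} {ξ : E3}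
    (h : (2 : ℝ) ^ (q + 1) ≤ ‖ξ‖) : lpSymbol χ q ξ = 0 := by
  unfold lpSymbol
  split_ifs with h1 h2
  · rw [hχ.two_zpow_smul_eq_zero h, hχ.two_zpow_smul_eq_zero, sub_zero]
    exact (zpow_le_zpow_right₀ (by norm_num) (by lia)).trans h
  · subst h2
    exact hχ.eq_zero _ (by simpa using h)
  · rfl

lemma IsCutoff.lpSymbol_eq_zero_of_ge {χ : E3 → ℝ} (hχ : IsCutoff χ) {q : ℤ} (hq : 0 ≤ q) {ξ : E3}
    (h : ‖ξ‖ ≤ 3 / 4 * (2 : ℝ) ^ q) : lpSymbol χ q ξ = 0 := by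
  rw [lpSymbol_of_nonneg hq, hχ.two_zpow_smul_eq_one h, hχ.two_zpow_smul_eq_one, sub_self]
  refine h.trans ?_
  gcongr
  · norm_num
  · lia

lemma IsCutoff.abs_lpSymbol_le {χ : E3 → ℝ} (hχ : IsCutoff χ) {M : ℝ} (hM : ∀ ξ, χ ξ ≤ M)
    (q : ℤ) (ξ : E3) : |lpSymbol χ q ξ| ≤ M := by
  have hM0 : 0 ≤ M := (hχ.nonneg 0).trans (hM 0)
  unfold lpSymbol
  split_ifs with h1 h2
  · exact abs_sub_le_of_nonneg_of_le (hχ.nonneg _) (hM _) (hχ.nonneg _) (hM _)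
  · rw [abs_of_nonneg (hχ.nonneg _)]; exact hM _
  · simpa using hM0

lemma abs_le_norm_freqVec (k : Freq) (i : Fin 3) : |(k i : ℝ)| ≤ ‖freqVec k‖ :=
  PiLp.norm_apply_le (freqVec k) i

lemma finite_freq (R : ℝ) : {k : Freq | ‖freqVec k‖ ≤ R}.Finite := by
  refine (Set.finite_Icc (fun _ => -⌈R⌉ : Freq) (fun _ => ⌈R⌉)).subset fun k hk => ?_
  have h : ∀ i, |k i| ≤ ⌈R⌉ := fun i => by
    have := ((abs_le_norm_freqVec k i).trans hk).trans (Int.le_ceil R)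
    exact_mod_cast this
  exact ⟨fun i => (abs_le.1 (h i)).1, fun i => (abs_le.1 (h i)).2⟩

lemma one_le_norm_freqVec {k : Freq} (hk : k ≠ 0) : 1 ≤ ‖freqVec k‖ := by
  obtain ⟨i, hi⟩ := Function.ne_iff.1 hk
  refine le_trans ?_ (abs_le_norm_freqVec k i)
  exact_mod_cast Int.one_le_abs hi

/-- The frequencies with `|k| ≤ 2^{q+1}`; they contain the support of `φ_q`. -/
def blockFreq (q : ℤ) : Finset Freq := (finite_freq ((2 : ℝ) ^ (q + 1))).toFinset

lemma mem_blockFreq {q : ℤ} {k : Freq} : k ∈ blockFreq q ↔ ‖freqVec k‖ ≤ (2 : ℝ) ^ (q + 1) := by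
  simp [blockFreq]

lemma IsCutoff.lpSymbol_eq_zero_of_notMem {χ : E3 → ℝ} (hχ : IsCutoff χ) {q : ℤ} {k : Freq}
    (hk : k ∉ blockFreq q) : lpSymbol χ q (freqVec k) = 0 :=
  hχ.lpSymbol_eq_zero_of_le (not_le.1 fun h => hk (mem_blockFreq.2 h)).le

lemma IsCutoff.lpBlock_eq_sum {χ : E3 → ℝ} (hχ : IsCutoff χ) (L : ℝ) (a : Freq → C3) (q : ℤ)
    (x : E3) : lpBlock χ L a q x = ∑ k ∈ blockFreq q,
      Complex.exp ((phase L k x : ℂ) * Complex.I) • ((lpSymbol χ q (freqVec k) : ℂ) • a k) := by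
  unfold lpBlock
  rw [tsum_eq_sum (s := blockFreq q) fun k hk => by
    rw [hχ.lpSymbol_eq_zero_of_notMem hk]; simp]
  simp only [smul_smul, mul_comm]

lemma continuous_phase (L : ℝ) (k : Freq) : Continuous (phase L k) := by
  unfold phase; fun_prop

lemma phase_add_smul (L : ℝ) (k : Freq) (x y : E3) (s : ℝ) :
    phase L k (x + s • y) = phase L k x + s * phase L k y := by
  simp only [phase, inner_add_right, inner_smul_right]; ring

lemma IsCutoff.contDiff_lpBlock {χ : E3 → ℝ} (hχ : IsCutoff χ) (L : ℝ) (a : Freq → C3) (q : ℤ) :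
    ContDiff ℝ 1 (lpBlock χ L a q) := by
  rw [funext (hχ.lpBlock_eq_sum L a q)]
  refine ContDiff.sum fun k _ => ContDiff.smul (ContDiff.cexp (ContDiff.mul ?_ contDiff_const))
    contDiff_const
  refine Complex.ofRealCLM.contDiff.comp ?_
  exact contDiff_const.mul (contDiff_const.inner ℝ contDiff_id)

lemma IsCutoff.contDiff_lpLow {χ : E3 → ℝ} (hχ : IsCutoff χ) (L : ℝ) (a : Freq → C3) (q : ℤ) :
    ContDiff ℝ 1 (lpLow χ L a q) := by
  unfold lpLow
  exact ContDiff.sum fun p _ => hχ.contDiff_lpBlock L a p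

lemma isPeriodic_lpBlock {χ : E3 → ℝ} {L : ℝ} (hL : 0 < L) (a : Freq → C3) (q : ℤ) :
    IsPeriodic L (lpBlock χ L a q) := by
  intro x m
  unfold lpBlock
  refine tsum_congr fun k => ?_
  have e : phase L k (x + L • freqVec m) = phase L k x + (∑ i, k i * m i : ℤ) * (2 * Real.pi) := by
    rw [phase_add_smul, add_right_inj, phase_eq]
    simp only [freqVec_apply]
    push_cast
    field_simp
  rw [e]
  have : (((phase L k x + (∑ i, k i * m i : ℤ) * (2 * Real.pi) : ℝ) : ℂ)) * Complex.I
      = phase L k x * Complex.I + (∑ i, k i * m i : ℤ) * (2 * Real.pi * Complex.I) := by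
    push_cast; ring
  rw [this, Complex.exp_add, Complex.exp_int_mul_two_pi_mul_I, mul_one]

lemma isPeriodic_lpLow {χ : E3 → ℝ} {L : ℝ} (hL : 0 < L) (a : Freq → C3) (q : ℤ) :
    IsPeriodic L (lpLow χ L a q) := fun x m => by
  unfold lpLow
  exact Finset.sum_congr rfl fun p _ => isPeriodic_lpBlock hL a p x m

lemma isPeriodic_gradAbs {L : ℝ} {w : E3 → C3} (hw : IsPeriodic L w) :
    IsPeriodic L (gradAbs w) := fun x m => by
  have h : (fun y => w (y + L • freqVec m)) = w := funext fun y => hw y m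
  unfold gradAbs
  rw [← fderiv_comp_add_right, h]

lemma continuous_gradAbs {w : E3 → C3} (hw : ContDiff ℝ 1 w) : Continuous (gradAbs w) := by
  unfold gradAbs
  have := hw.continuous_fderiv (by norm_num)
  fun_prop

/-! ### Suprema of continuous periodic functions -/

instance (L : ℝ) : IsFiniteMeasure (torusMeasure L) := by
  refine ⟨?_⟩
  unfold torusMeasure
  rw [Measure.restrict_apply_univ]
  refine (Bornology.IsBounded.measure_lt_top ?_)
  refine (Metric.isBounded_closedBall (x := (0 : E3)) (r := Real.sqrt (3 * L ^ 2))).subset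
    fun x hx => ?_
  rw [mem_closedBall_zero_iff, EuclideanSpace.norm_eq]
  refine Real.sqrt_le_sqrt ?_
  calc ∑ i, ‖x i‖ ^ 2 ≤ ∑ _i : Fin 3, L ^ 2 := by
        refine Finset.sum_le_sum fun i _ => ?_
        rw [Real.norm_of_nonneg (hx i).1]
        exact pow_le_pow_left₀ (hx i).1 (hx i).2.le 2
    _ = 3 * L ^ 2 := by simp

lemma exists_mem_cell {L : ℝ} (hL : 0 < L) (x : E3) :
    ∃ y ∈ cell L, ∃ k : Freq, x = y + L • freqVec k := by
  refine ⟨x - L • freqVec (fun i => ⌊x i / L⌋), fun i => ?_, _, (sub_add_cancel _ _).symm⟩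
  have h1 := Int.floor_le (x i / L)
  have h2 := Int.lt_floor_add_one (x i / L)
  rw [le_div_iff₀ hL] at h1
  rw [div_lt_iff₀ hL] at h2
  simp only [PiLp.sub_apply, PiLp.smul_apply, freqVec_apply, smul_eq_mul, mem_Ico]
  constructor <;> nlinarith

/-- The essential supremum over a fundamental cell of a continuous periodic function bounds it
everywhere. -/
lemma enorm_le_eLpNorm_top {F : Type*} [NormedAddCommGroup F] {L : ℝ} (hL : 0 < L) {w : E3 → F}
    (hw : Continuous w) (hp : IsPeriodic L w) (x : E3) :
    ‖w x‖ₑ ≤ eLpNorm w ⊤ (torusMeasure L) := by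
  obtain ⟨y, hy, k, rfl⟩ := exists_mem_cell hL x
  rw [hp]
  set S := eLpNorm w ⊤ (torusMeasure L) with hS
  let U : Set E3 := {z | ∀ i, z i ∈ Ioo 0 L}
  have hUo : IsOpen U := by
    have : U = ⋂ i, (fun z : E3 => z i) ⁻¹' Ioo 0 L := by ext; simp [U]
    rw [this]
    exact isOpen_iInter_of_finite fun i => isOpen_Ioo.preimage (by fun_prop)
  have hUc : U ⊆ cell L := fun z hz i => Ioo_subset_Ico_self (hz i)
  have hU : ∀ z ∈ U, ‖w z‖ₑ ≤ S := by
    intro z hz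
    by_contra! hlt
    have hVo : IsOpen (U ∩ {z | S < ‖w z‖ₑ}) :=
      hUo.inter (isOpen_lt continuous_const hw.enorm)
    have hpos := hVo.measure_pos volume ⟨z, hz, hlt⟩
    have hae : ∀ᵐ z ∂(torusMeasure L), ‖w z‖ₑ ≤ S := by
      rw [hS, eLpNorm_exponent_top]
      exact enorm_ae_le_eLpNormEssSup w _
    rw [torusMeasure, ae_restrict_iff' (measurableSet_cell L), ae_iff] at hae
    refine hpos.ne' (measure_mono_null ?_ hae)
    rintro z ⟨h1, h2⟩
    simpa using ⟨hUc h1, h2⟩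
  -- a point of the half-open cell is the limit of points of the open cell
  let e : E3 := WithLp.toLp 2 fun _ => 1
  have hlim : Filter.Tendsto (fun ε : ℝ => ‖w (y + ε • e)‖ₑ) (nhdsWithin 0 (Ioi 0))
      (nhds ‖w y‖ₑ) := by
    have : Continuous fun ε : ℝ => ‖w (y + ε • e)‖ₑ := by fun_prop
    have := (this.tendsto 0).mono_left (nhdsWithin_le_nhds (s := Ioi 0))
    simpa using this
  refine le_of_tendsto hlim ?_
  have hev : ∀ i, ∀ᶠ ε : ℝ in nhdsWithin 0 (Ioi 0), (y + ε • e) i ∈ Ioo 0 L := by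
    intro i
    filter_upwards [Ioo_mem_nhdsGT (sub_pos.2 (hy i).2)] with ε hε
    have h1 := (hy i).1
    simp only [PiLp.add_apply, PiLp.smul_apply, e, smul_eq_mul, mul_one, mem_Ioo]
    constructor <;> linarith [hε.1, hε.2]
  filter_upwards [Filter.eventually_all.2 hev] with ε hε
  exact hU _ hε

/-- The essential supremum as a supremum over a countable set, which makes its dependence on
parameters measurable. -/
lemma eLpNorm_top_eq_iSup {F : Type*} [NormedAddCommGroup F] {L : ℝ} (hL : 0 < L) {w : E3 → F}
    (hw : Continuous w) (hp : IsPeriodic L w) :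
    eLpNorm w ⊤ (torusMeasure L) = ⨆ n : ℕ, ‖w (TopologicalSpace.denseSeq E3 n)‖ₑ := by
  refine le_antisymm ?_ (iSup_le fun n => enorm_le_eLpNorm_top hL hw hp _)
  rw [eLpNorm_exponent_top]
  refine eLpNormEssSup_le_of_ae_enorm_bound (.of_forall fun x => ?_)
  have hcl : IsClosed {x | ‖w x‖ₑ ≤ ⨆ n : ℕ, ‖w (TopologicalSpace.denseSeq E3 n)‖ₑ} :=
    isClosed_le hw.enorm continuous_const
  refine closure_minimal (s := range (TopologicalSpace.denseSeq E3)) ?_ hcl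
    (TopologicalSpace.denseRange_denseSeq E3 x)
  rintro _ ⟨n, rfl⟩
  exact le_iSup (fun n => ‖w (TopologicalSpace.denseSeq E3 n)‖ₑ) n

/-! ### Norms of the blocks -/

lemma IsCutoff.exists_norm_lpBlock_le {χ : E3 → ℝ} (hχ : IsCutoff χ) (L : ℝ) (a : Freq → C3)
    (q : ℤ) :
    ∃ B : ℝ, ∀ x, ‖lpBlock χ L a q x‖ ≤ B := by
  refine ⟨∑ k ∈ blockFreq q, ‖(lpSymbol χ q (freqVec k) : ℂ) • a k‖, fun x => ?_⟩
  rw [hχ.lpBlock_eq_sum]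
  refine (norm_sum_le _ _).trans (Finset.sum_le_sum fun k _ => ?_)
  rw [norm_smul, Complex.norm_exp_ofReal_mul_I, one_mul]

lemma IsCutoff.blockNorm_top_ne_top {χ : E3 → ℝ} (hχ : IsCutoff χ) (L : ℝ) (a : Freq → C3) (q : ℤ) :
    blockNorm χ L ⊤ a q ≠ ⊤ := by
  obtain ⟨B, hB⟩ := hχ.exists_norm_lpBlock_le L a q
  unfold blockNorm
  rw [eLpNorm_exponent_top]
  refine ((eLpNormEssSup_le_of_ae_bound (.of_forall hB)).trans_lt ENNReal.ofReal_lt_top).ne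

lemma IsCutoff.norm_lpBlock_le {χ : E3 → ℝ} (hχ : IsCutoff χ) {L : ℝ} (hL : 0 < L) (a : Freq → C3)
    (q : ℤ) (x : E3) : ‖lpBlock χ L a q x‖ ≤ (blockNorm χ L ⊤ a q).toReal := by
  have := enorm_le_eLpNorm_top hL (hχ.contDiff_lpBlock L a q).continuous
    (isPeriodic_lpBlock hL a q) x
  rw [← toReal_enorm]
  exact ENNReal.toReal_mono (hχ.blockNorm_top_ne_top L a q) this

lemma IsCutoff.fderiv_lpBlock {χ : E3 → ℝ} (hχ : IsCutoff χ) (L : ℝ) (a : Freq → C3) (q : ℤ)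
    (x v : E3) : fderiv ℝ (lpBlock χ L a q) x v = ∑ k ∈ blockFreq q,
      (Complex.I * phase L k v) • (Complex.exp ((phase L k x : ℂ) * Complex.I) •
        ((lpSymbol χ q (freqVec k) : ℂ) • a k)) := by
  have h : HasFDerivAt (lpBlock χ L a q) (fderiv ℝ (lpBlock χ L a q) x) (x + (0 : ℝ) • v) := by
    simpa using ((hχ.contDiff_lpBlock L a q).differentiable (by norm_num) x).hasFDerivAt
  have h1 : HasDerivAt (fun s : ℝ => x + s • v) v 0 := by
    simpa using ((hasDerivAt_id (0 : ℝ)).smul_const v).const_add x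
  have h2 := h.comp_hasDerivAt (0 : ℝ) h1
  refine h2.unique ?_
  have e : (lpBlock χ L a q ∘ fun s : ℝ => x + s • v) = fun s : ℝ => ∑ k ∈ blockFreq q,
      Complex.exp (((phase L k x + s * phase L k v : ℝ) : ℂ) * Complex.I) •
        ((lpSymbol χ q (freqVec k) : ℂ) • a k) := by
    funext s
    simp only [Function.comp, hχ.lpBlock_eq_sum, phase_add_smul]
  rw [e]
  refine HasDerivAt.fun_sum fun k _ => ?_
  have h3 : HasDerivAt (fun s : ℝ => ((phase L k x + s * phase L k v : ℝ) : ℂ) * Complex.I)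
      (phase L k v * Complex.I) 0 := by
    refine HasDerivAt.mul_const ?_ _
    refine HasDerivAt.ofReal_comp ?_
    simpa using ((hasDerivAt_id (0 : ℝ)).mul_const (phase L k v)).const_add (phase L k x)
  have := h3.cexp.smul_const ((lpSymbol χ q (freqVec k) : ℂ) • a k)
  convert this using 1
  simp only [zero_mul, add_zero, smul_smul]
  ring_nf

lemma phase_single (L : ℝ) (k : Freq) (i : Fin 3) :
    phase L k (EuclideanSpace.single i 1) = 2 * Real.pi / L * k i := by
  rw [phase_eq]
  congr 1
  rw [Finset.sum_eq_single i] <;> simp +contextual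

/-- **Bernstein's inequality** for the partial derivatives of a block, in `L^∞`. -/
lemma IsCutoff.norm_fderiv_lpBlock_le {χ : E3 → ℝ} (hχ : IsCutoff χ) {L : ℝ} (hL : 0 < L)
    (a : Freq → C3) (q : ℤ) (x : E3) (i : Fin 3) :
    ‖fderiv ℝ (lpBlock χ L a q) x (EuclideanSpace.single i 1)‖
      ≤ 4 * Real.pi * Real.exp 1 * (lam L q * (blockNorm χ L ⊤ a q).toReal) := by
  rw [hχ.fderiv_lpBlock]
  have h := norm_deriv_expSum_le (s := blockFreq q)
    (θ := fun k => phase L k (EuclideanSpace.single i 1))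
    (a := fun k => Complex.exp ((phase L k x : ℂ) * Complex.I) •
        ((lpSymbol χ q (freqVec k) : ℂ) • a k))
    (N := 2 * Real.pi / L * 2 ^ (q + 1)) (B := (blockNorm χ L ⊤ a q).toReal) (by positivity)
    (fun k hk => by
      rw [phase_single, abs_mul, abs_of_pos (by positivity)]
      gcongr
      exact (abs_le_norm_freqVec k i).trans (mem_blockFreq.1 hk))
    (fun s => by
      have := hχ.norm_lpBlock_le hL a q (x + s • EuclideanSpace.single i 1)
      rw [hχ.lpBlock_eq_sum] at this
      refine (congrArg norm (Finset.sum_congr rfl fun k _ => ?_)).trans_le this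
      rw [phase_add_smul, smul_smul, ← Complex.exp_add]
      push_cast
      congr 2
      ring)
  refine h.trans (le_of_eq ?_)
  rw [lam, zpow_add₀ (by norm_num), zpow_one]
  ring

lemma gradAbs_le_sum (w : E3 → C3) (x : E3) :
    gradAbs w x ≤ ∑ i : Fin 3, ‖fderiv ℝ w x (EuclideanSpace.single i 1)‖ := by
  unfold gradAbs
  refine Real.sqrt_le_iff.2 ⟨Finset.sum_nonneg fun _ _ => norm_nonneg _, ?_⟩
  exact Finset.sum_sq_le_sq_sum_of_nonneg fun _ _ => norm_nonneg _

lemma IsCutoff.fderiv_lpLow {χ : E3 → ℝ} (hχ : IsCutoff χ) (L : ℝ) (a : Freq → C3) (Q : ℤ)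
    (x v : E3) : fderiv ℝ (lpLow χ L a Q) x v
      = ∑ q ∈ Finset.Icc (-1) Q, fderiv ℝ (lpBlock χ L a q) x v := by
  have : lpLow χ L a Q = fun y => ∑ q ∈ Finset.Icc (-1) Q, lpBlock χ L a q y := rfl
  rw [this, fderiv_fun_sum fun q _ => (hχ.contDiff_lpBlock L a q).differentiable (by norm_num) x]
  simp

/-- The gradient of the low modes, in `L^∞`. -/
lemma IsCutoff.eLpNorm_gradAbs_lpLow_le {χ : E3 → ℝ} (hχ : IsCutoff χ) {L : ℝ} (hL : 0 < L)
    (a : Freq → C3) (Q : ℤ) :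
    eLpNorm (gradAbs (lpLow χ L a Q)) ⊤ (torusMeasure L) ≤ ENNReal.ofReal
      (12 * Real.pi * Real.exp 1 *
        ∑ q ∈ Finset.Icc (-1) Q, lam L q * (blockNorm χ L ⊤ a q).toReal) := by
  rw [eLpNorm_exponent_top]
  refine eLpNormEssSup_le_of_ae_bound (.of_forall fun x => ?_)
  have h0 : 0 ≤ gradAbs (lpLow χ L a Q) x := Real.sqrt_nonneg _
  rw [Real.norm_of_nonneg h0]
  calc gradAbs (lpLow χ L a Q) x
      ≤ ∑ i : Fin 3, ‖fderiv ℝ (lpLow χ L a Q) x (EuclideanSpace.single i 1)‖ := gradAbs_le_sum _ _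
    _ ≤ ∑ _i : Fin 3, ∑ q ∈ Finset.Icc (-1) Q,
          4 * Real.pi * Real.exp 1 * (lam L q * (blockNorm χ L ⊤ a q).toReal) := by
        refine Finset.sum_le_sum fun i _ => ?_
        rw [hχ.fderiv_lpLow]
        exact (norm_sum_le _ _).trans
          (Finset.sum_le_sum fun q _ => hχ.norm_fderiv_lpBlock_le hL a q x i)
    _ = _ := by
        rw [← Finset.mul_sum]
        simp
        ring

/-- **Parseval's identity** for a block. -/
lemma IsCutoff.blockNorm_two_sq {χ : E3 → ℝ} (hχ : IsCutoff χ) {L : ℝ} (hL : 0 < L)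
    (a : Freq → C3) (q : ℤ) : blockNorm χ L 2 a q ^ 2
      = ∑' k : Freq, ENNReal.ofReal (L ^ 3 * (lpSymbol χ q (freqVec k) ^ 2 * ‖a k‖ ^ 2)) := by
  obtain ⟨B, hB⟩ := hχ.exists_norm_lpBlock_le L a q
  have hcont := (hχ.contDiff_lpBlock L a q).continuous
  have hmem : MemLp (lpBlock χ L a q) 2 (torusMeasure L) :=
    MemLp.of_bound hcont.aestronglyMeasurable B (.of_forall hB)
  have h1 : blockNorm χ L 2 a q ^ 2
      = ENNReal.ofReal (∫ x, ‖lpBlock χ L a q x‖ ^ 2 ∂(torusMeasure L)) := by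
    rw [ofReal_integral_eq_lintegral_ofReal (hmem.integrable_norm_pow (by norm_num))
      (.of_forall fun x => by positivity)]
    have := eLpNorm_nnreal_pow_eq_lintegral (f := lpBlock χ L a q) (μ := torusMeasure L) (p := 2)
      (by norm_num)
    unfold blockNorm
    have e : eLpNorm (lpBlock χ L a q) 2 (torusMeasure L) ^ 2
      = eLpNorm (lpBlock χ L a q) (2 : ℝ≥0) (torusMeasure L) ^ ((2 : ℝ≥0) : ℝ) := by
      norm_num
    rw [e, this]
    refine lintegral_congr fun x => ?_
    rw [ENNReal.ofReal_pow (norm_nonneg _), ofReal_norm]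
    norm_num
  rw [h1]
  simp_rw [hχ.lpBlock_eq_sum]
  rw [integral_norm_sq_trigPoly hL, tsum_eq_sum (s := blockFreq q) fun k hk => by
    rw [hχ.lpSymbol_eq_zero_of_notMem hk]; simp]
  rw [Finset.mul_sum, ENNReal.ofReal_sum_of_nonneg fun k _ => by positivity]
  refine Finset.sum_congr rfl fun k _ => ?_
  rw [norm_smul, mul_pow, Complex.norm_real, Real.norm_eq_abs, sq_abs]

/-! ### Comparison of dyadic and spectral Sobolev norms -/

lemma exists_two_pow_near {k : Freq} (hk : k ≠ 0) :
    ∃ m : ℕ, (2 : ℝ) ^ m ≤ ‖freqVec k‖ ∧ ‖freqVec k‖ < (2 : ℝ) ^ (m + 1) :=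
  exists_nat_pow_near (one_le_norm_freqVec hk) (by norm_num)

/-- If `2^m ≤ |k| < 2^{m+1}`, only the blocks `m` and `m + 1` see the frequency `k`. -/
lemma IsCutoff.tsum_lpSymbol_sq {χ : E3 → ℝ} (hχ : IsCutoff χ) {k : Freq} {m : ℕ}
    (h1 : (2 : ℝ) ^ m ≤ ‖freqVec k‖) (h2 : ‖freqVec k‖ < (2 : ℝ) ^ (m + 1)) (g : ℤ → ℝ) :
    ∑' n : ℕ, ENNReal.ofReal (g (n - 1) * lpSymbol χ (n - 1) (freqVec k) ^ 2)
      = ENNReal.ofReal (g m * lpSymbol χ m (freqVec k) ^ 2)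
        + ENNReal.ofReal (g (m + 1) * lpSymbol χ (m + 1) (freqVec k) ^ 2) := by
  rw [tsum_eq_sum (s := {m + 1, m + 2})]
  · rw [Finset.sum_pair (by simp)]
    push_cast
    congr 4 <;> ring_nf
  · intro n hn
    simp only [Finset.mem_insert, Finset.mem_singleton, not_or] at hn
    have : lpSymbol χ (n - 1) (freqVec k) = 0 := by
      rcases lt_or_ge n (m + 1) with h | h
      · refine hχ.lpSymbol_eq_zero_of_le (le_trans ?_ h1)
        rw [← zpow_natCast]
        exact zpow_le_zpow_right₀ (by norm_num) (by lia)
      · have h3 : m + 3 ≤ n := by lia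
        refine hχ.lpSymbol_eq_zero_of_ge (by lia) (h2.le.trans ?_)
        have h4 : (2 : ℝ) ^ (m + 2) ≤ (2 : ℝ) ^ ((n : ℤ) - 1) := by
          rw [← zpow_natCast]
          exact zpow_le_zpow_right₀ (by norm_num) (by push_cast; lia)
        rw [pow_succ, pow_succ] at h4
        rw [pow_succ]
        nlinarith [pow_pos (two_pos : (0 : ℝ) < 2) m]
    rw [this]; simp

/-- If `2^m ≤ |k| < 2^{m+1}`, then `φ_m(k) + φ_{m+1}(k) = 1`. -/
lemma IsCutoff.lpSymbol_succ_eq {χ : E3 → ℝ} (hχ : IsCutoff χ) {ξ : E3} {m : ℕ}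
    (h1 : (2 : ℝ) ^ m ≤ ‖ξ‖) (h2 : ‖ξ‖ < (2 : ℝ) ^ (m + 1)) :
    lpSymbol χ (m + 1) ξ = 1 - lpSymbol χ m ξ := by
  rw [lpSymbol_of_nonneg (by lia), lpSymbol_of_nonneg (by lia),
    hχ.two_zpow_smul_eq_one (q := (m : ℤ) + 1 + 1),
    hχ.two_zpow_smul_eq_zero (q := (m : ℤ)) (by simpa using h1), sub_zero]
  refine h2.le.trans ?_
  rw [zpow_add₀ (by norm_num) _ (1 : ℤ), zpow_add₀ (by norm_num), zpow_natCast, zpow_one, pow_succ]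
  nlinarith [pow_pos (two_pos : (0 : ℝ) < 2) m]

lemma IsCutoff.lpSymbol_eq_one {χ : E3 → ℝ} (hχ : IsCutoff χ) {ξ : E3} {m : ℕ}
    (h1 : (2 : ℝ) ^ m ≤ ‖ξ‖) (h2 : ‖ξ‖ ≤ 3 / 2 * (2 : ℝ) ^ m) : lpSymbol χ m ξ = 1 := by
  rw [lpSymbol_of_nonneg (by lia), hχ.two_zpow_smul_eq_one (q := (m : ℤ) + 1),
    hχ.two_zpow_smul_eq_zero (q := (m : ℤ)) (by simpa using h1), sub_zero]
  rw [zpow_add₀ (by norm_num), zpow_natCast, zpow_one]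
  linarith

lemma lam_natCast (L : ℝ) (m : ℕ) : lam L m = 2 ^ m / L := by
  simp [lam]

lemma lam_natCast_succ (L : ℝ) (m : ℕ) : lam L (m + 1) = 2 * (2 ^ m / L) := by
  rw [lam, zpow_add₀ (by norm_num), zpow_natCast, zpow_one]
  ring

/-- The weighted square function of the blocks, as a sum over frequencies. -/
lemma IsCutoff.tsum_blockNorm_two_sq {χ : E3 → ℝ} (hχ : IsCutoff χ) {L : ℝ} (hL : 0 < L)
    (a : Freq → C3) {g : ℤ → ℝ} (hg : ∀ q, 0 ≤ g q) :
    ∑' n : ℕ, ENNReal.ofReal (g (n - 1)) * blockNorm χ L 2 a (n - 1) ^ 2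
      = ∑' k : Freq, ENNReal.ofReal (L ^ 3 * ‖a k‖ ^ 2)
        * ∑' n : ℕ, ENNReal.ofReal (g (n - 1) * lpSymbol χ (n - 1) (freqVec k) ^ 2) := by
  simp_rw [hχ.blockNorm_two_sq hL, ← ENNReal.tsum_mul_left]
  rw [ENNReal.tsum_comm]
  refine tsum_congr fun k => tsum_congr fun n => ?_
  rw [← ENNReal.ofReal_mul (hg _), ← ENNReal.ofReal_mul (by positivity)]
  congr 1
  ring

/-- `∑_q λ_q² ‖u_q‖²` is controlled by `‖∇u‖²`. -/
lemma IsCutoff.tsum_lam_sq_blockNorm_le {χ : E3 → ℝ} (hχ : IsCutoff χ) {M : ℝ} (hM : ∀ ξ, χ ξ ≤ M)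
    {L : ℝ} (hL : 0 < L) {v : E3 → E3} (hv : fourierCoeff L v 0 = 0) :
    ∑' n : ℕ, ENNReal.ofReal (lam L (n - 1) ^ 2) * blockNorm χ L 2 (fourierCoeff L v) (n - 1) ^ 2
      ≤ ENNReal.ofReal (5 * M ^ 2) * gradNormSq L v := by
  rw [hχ.tsum_blockNorm_two_sq hL _ (g := fun q => lam L q ^ 2) fun q => by positivity]
  unfold gradNormSq
  rw [← ENNReal.tsum_mul_left]
  refine ENNReal.tsum_le_tsum fun k => ?_
  rcases eq_or_ne k 0 with rfl | hk
  · simp [hv]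
  obtain ⟨m, h1, h2⟩ := exists_two_pow_near hk
  have hT := hχ.tsum_lpSymbol_sq h1 h2 (fun q => lam L q ^ 2)
  refine (mul_le_mul_right hT.le _).trans ?_
  have b1 := sq_le_sq' (abs_le.1 (hχ.abs_lpSymbol_le hM m (freqVec k))).1
    (abs_le.1 (hχ.abs_lpSymbol_le hM m (freqVec k))).2
  have b2 := sq_le_sq' (abs_le.1 (hχ.abs_lpSymbol_le hM (m + 1) (freqVec k))).1
    (abs_le.1 (hχ.abs_lpSymbol_le hM (m + 1) (freqVec k))).2
  rw [← ENNReal.ofReal_add (by positivity) (by positivity), ← ENNReal.ofReal_mul (by positivity),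
    ← ENNReal.ofReal_mul (by positivity)]
  refine ENNReal.ofReal_le_ofReal ?_
  have key : lam L m ^ 2 * lpSymbol χ m (freqVec k) ^ 2
      + lam L (m + 1) ^ 2 * lpSymbol χ (m + 1) (freqVec k) ^ 2
      ≤ 5 * M ^ 2 * (2 * Real.pi / L * ‖freqVec k‖) ^ 2 := by
    rw [lam_natCast, lam_natCast_succ]
    have h3 : (2 ^ m / L : ℝ) ≤ 2 * Real.pi / L * ‖freqVec k‖ := by
      rw [div_mul_eq_mul_div]
      gcongr
      exact h1.trans (le_mul_of_one_le_left (norm_nonneg _) (by linarith [Real.pi_gt_three]))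
    calc _ ≤ (2 ^ m / L : ℝ) ^ 2 * M ^ 2 + (2 * (2 ^ m / L : ℝ)) ^ 2 * M ^ 2 := by gcongr
      _ = 5 * M ^ 2 * (2 ^ m / L : ℝ) ^ 2 := by ring
      _ ≤ _ := by gcongr
  calc _ = L ^ 3 * ‖fourierCoeff L v k‖ ^ 2 * (lam L m ^ 2 * lpSymbol χ m (freqVec k) ^ 2
      + lam L (m + 1) ^ 2 * lpSymbol χ (m + 1) (freqVec k) ^ 2) := by ring
    _ ≤ L ^ 3 * ‖fourierCoeff L v k‖ ^ 2 *
          (5 * M ^ 2 * (2 * Real.pi / L * ‖freqVec k‖) ^ 2) := by gcongr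
    _ = _ := by ring

/-- The square of the dual norm of `‖∇·‖_{L²}`: `L³ ∑ₖ |2πk/L|⁻² |g(k)|²`, the sum running over
`k ≠ 0` (the term `k = 0` vanishes since `0⁻¹ = 0`). -/
def dualNormSq (L : ℝ) (g : Freq → C3) : ℝ≥0∞ :=
  ∑' k : Freq, ENNReal.ofReal (L ^ 3 * ((2 * Real.pi / L * ‖freqVec k‖)⁻¹) ^ 2 * ‖g k‖ ^ 2)

/-- The dyadic `H⁻¹` norm, whose weights are `λ_q = 2^q / L` without the factor `2π`, exceeds the
spectral dual norm by more than `√10`; this leaves room for the constants of the energy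
estimates. -/
lemma IsCutoff.ten_mul_dualNormSq_le {χ : E3 → ℝ} (hχ : IsCutoff χ) {L : ℝ} (hL : 0 < L)
    (g : Freq → C3) : ENNReal.ofReal 10 * dualNormSq L g ≤ sobolevNorm χ L (-1) g ^ 2 := by
  have e : sobolevNorm χ L (-1) g ^ 2 = ∑' n : ℕ,
      ENNReal.ofReal (lam L (n - 1) ^ (2 * (-1) : ℝ)) * blockNorm χ L 2 g (n - 1) ^ 2 := by
    unfold sobolevNorm
    rw [← ENNReal.rpow_natCast, ← ENNReal.rpow_mul]
    norm_num
  rw [e, hχ.tsum_blockNorm_two_sq hL _ (g := fun q => lam L q ^ (2 * (-1) : ℝ)) fun q =>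
    Real.rpow_nonneg (lam_pos hL q).le _]
  unfold dualNormSq
  rw [← ENNReal.tsum_mul_left]
  refine ENNReal.tsum_le_tsum fun k => ?_
  rcases eq_or_ne k 0 with rfl | hk
  · have : freqVec 0 = 0 := by ext i; simp [freqVec]
    simp [this]
  obtain ⟨m, h1, h2⟩ := exists_two_pow_near hk
  have hT := hχ.tsum_lpSymbol_sq h1 h2 (fun q => lam L q ^ (2 * (-1) : ℝ))
  refine le_trans ?_ (mul_le_mul_right hT.ge _)
  have r1 := Real.rpow_nonneg (lam_pos hL m).le (2 * (-1))
  have r2 := Real.rpow_nonneg (lam_pos hL (m + 1)).le (2 * (-1))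
  rw [← ENNReal.ofReal_add (by positivity) (by positivity), ← ENNReal.ofReal_mul (by positivity),
    ← ENNReal.ofReal_mul (by positivity)]
  refine ENNReal.ofReal_le_ofReal ?_
  have hinv : ∀ x : ℝ, 0 < x → x ^ (2 * (-1) : ℝ) = (x ^ 2)⁻¹ := fun x hx => by
    rw [show (2 * (-1) : ℝ) = -((2 : ℕ) : ℝ) by norm_num, Real.rpow_neg hx.le, Real.rpow_natCast]
  have h0 : (0 : ℝ) < 2 ^ m := by positivity
  have key : 10 * ((2 * Real.pi / L * ‖freqVec k‖)⁻¹) ^ 2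
      ≤ lam L m ^ (2 * (-1) : ℝ) * lpSymbol χ m (freqVec k) ^ 2
      + lam L (m + 1) ^ (2 * (-1) : ℝ) * lpSymbol χ (m + 1) (freqVec k) ^ 2 := by
    rw [hinv _ (lam_pos hL m), hinv _ (lam_pos hL (m + 1)), lam_natCast, lam_natCast_succ,
      hχ.lpSymbol_succ_eq h1 h2]
    set s := lpSymbol χ m (freqVec k) with hs
    set r := ‖freqVec k‖ with hr
    have hr0 : 0 < r := zero_lt_one.trans_le (one_le_norm_freqVec hk)
    have e2 : ((2 ^ m / L : ℝ) ^ 2)⁻¹ * s ^ 2 + ((2 * (2 ^ m / L : ℝ)) ^ 2)⁻¹ * (1 - s) ^ 2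
        = (s ^ 2 + (1 - s) ^ 2 / 4) * ((2 ^ m / L : ℝ) ^ 2)⁻¹ := by
      rw [mul_pow, mul_inv]; ring
    rw [e2, inv_pow, ← div_eq_mul_inv, ← div_eq_mul_inv,
      div_le_div_iff₀ (by positivity) (by positivity)]
    have hpi : (36 : ℝ) ≤ (2 * Real.pi) ^ 2 := by nlinarith [Real.pi_gt_three]
    have e3 : (2 * Real.pi / L * r) ^ 2 = (2 * Real.pi) ^ 2 * (r / L) ^ 2 := by ring
    rw [e3]
    have hs0 : 0 ≤ s ^ 2 + (1 - s) ^ 2 / 4 := by positivity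
    have e4 : 10 * (2 ^ m / L : ℝ) ^ 2 ≤ (s ^ 2 + (1 - s) ^ 2 / 4) * (36 * (r / L) ^ 2) := by
      rcases le_total r (3 / 2 * 2 ^ m) with h | h
      · have : s = 1 := hχ.lpSymbol_eq_one h1 h
        rw [this]
        have : (2 ^ m / L : ℝ) ^ 2 ≤ (r / L) ^ 2 := by gcongr
        nlinarith
      · -- `s² + (1 - s)²/4` is at least `1/5`, and `|k|² ≥ (9/4) 4^m`
        have h5 : 1 / 5 ≤ s ^ 2 + (1 - s) ^ 2 / 4 := by nlinarith [sq_nonneg (5 * s - 1)]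
        have h6 : (3 / 2 * 2 ^ m / L : ℝ) ^ 2 ≤ (r / L) ^ 2 := by gcongr
        have h7 : (3 / 2 * 2 ^ m / L : ℝ) ^ 2 = 9 / 4 * (2 ^ m / L : ℝ) ^ 2 := by ring
        nlinarith [sq_nonneg (r / L), sq_nonneg (2 ^ m / L : ℝ)]
    refine e4.trans ?_
    gcongr
  calc _ = L ^ 3 * ‖g k‖ ^ 2 * (10 * ((2 * Real.pi / L * ‖freqVec k‖)⁻¹) ^ 2) := by ring
    _ ≤ _ := by gcongr

/-- Young's inequality for the pairing of a force with a velocity. -/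
lemma enorm_pairing_le {L ν : ℝ} (hL : 0 < L) (hν : 0 < ν) {g : Freq → C3} (hg : g 0 = 0)
    (v : E3 → E3) : ‖pairing L g v‖ₑ
      ≤ ENNReal.ofReal (ν / 2) * gradNormSq L v
        + ENNReal.ofReal (1 / (2 * ν)) * dualNormSq L g := by
  unfold pairing gradNormSq dualNormSq
  rw [← ENNReal.tsum_mul_left, ← ENNReal.tsum_mul_left, ← ENNReal.tsum_add, ← tsum_mul_left]
  refine enorm_tsum_le_tsum_enorm.trans (ENNReal.tsum_le_tsum fun k => ?_)
  rw [← ENNReal.ofReal_mul (by positivity), ← ENNReal.ofReal_mul (by positivity),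
    ← ENNReal.ofReal_add (by positivity) (by positivity), ← ofReal_norm]
  refine ENNReal.ofReal_le_ofReal ?_
  rcases eq_or_ne k 0 with rfl | hk
  · rw [hg]; simp; positivity
  have hk0 : 0 < ‖freqVec k‖ := zero_lt_one.trans_le (one_le_norm_freqVec hk)
  set a := ‖fourierCoeff L v k‖
  set b := ‖g k‖
  set κ := 2 * Real.pi / L * ‖freqVec k‖ with hκ
  have hκ0 : 0 < κ := by positivity
  rw [norm_mul, Real.norm_of_nonneg (by positivity)]
  have h1 : ‖(inner ℂ (fourierCoeff L v k) (g k) : ℂ).re‖ ≤ a * b :=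
    (Complex.abs_re_le_norm _).trans (norm_inner_le_norm _ _)
  have h2 : a * b ≤ ν / 2 * (κ ^ 2 * a ^ 2) + 1 / (2 * ν) * (κ⁻¹ ^ 2 * b ^ 2) := by
    have h3 := sq_nonneg (ν * κ * a - κ⁻¹ * b)
    have h4 : (ν * κ * a - κ⁻¹ * b) ^ 2 = 2 * ν * ((ν / 2 * (κ ^ 2 * a ^ 2)
        + 1 / (2 * ν) * (κ⁻¹ ^ 2 * b ^ 2)) - a * b) := by
      field_simp
      ring
    rw [h4] at h3
    nlinarith [nonneg_of_mul_nonneg_right h3 (by positivity : (0 : ℝ) < 2 * ν)]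
  calc _ ≤ L ^ 3 * (ν / 2 * (κ ^ 2 * a ^ 2) + 1 / (2 * ν) * (κ⁻¹ ^ 2 * b ^ 2)) := by
        gcongr; exact h1.trans h2
    _ = _ := by ring

lemma fourierCoeff_zero {L : ℝ} {v : E3 → E3} (hv : MemLp v 2 (torusMeasure L))
    (h0 : ∫ x, v x ∂(torusMeasure L) = 0) : fourierCoeff L v 0 = 0 := by
  ext j
  have h1 : ∀ x, phase L 0 x = 0 := fun x => by rw [phase_eq]; simp
  have h2 : ∫ x, v x j ∂(torusMeasure L) = 0 := by
    have := (EuclideanSpace.proj (𝕜 := ℝ) j : E3 →L[ℝ] ℝ).integral_comp_comm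
      (hv.integrable (by norm_num))
    rw [h0] at this
    simpa using this
  simp [fourierCoeff, h1, integral_complex_ofReal, h2]

/-- **Poincaré's inequality** on the torus. -/
lemma poincare {L : ℝ} (hL : 0 < L) {v : E3 → E3} (hv : MemLp v 2 (torusMeasure L))
    (h0 : fourierCoeff L v 0 = 0) :
    ENNReal.ofReal (kappa0 L ^ 2 * normSq L v) ≤ gradNormSq L v := by
  have h := hasSum_sq_fourierCoeff hL hv
  rw [← h.tsum_eq, ENNReal.ofReal_mul (by positivity),
    ENNReal.ofReal_tsum_of_nonneg (fun k => by positivity) h.summable, ← ENNReal.tsum_mul_left]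
  refine ENNReal.tsum_le_tsum fun k => ?_
  rw [← ENNReal.ofReal_mul (by positivity)]
  refine ENNReal.ofReal_le_ofReal ?_
  rcases eq_or_ne k 0 with rfl | hk
  · simp [h0]
  have h1 := one_le_norm_freqVec hk
  unfold kappa0
  have : (2 * Real.pi / L) ^ 2 ≤ (2 * Real.pi / L * ‖freqVec k‖) ^ 2 := by
    gcongr
    exact le_mul_of_one_le_right (by positivity) h1
  calc _ = L ^ 3 * (2 * Real.pi / L) ^ 2 * ‖fourierCoeff L v k‖ ^ 2 := by ring
    _ ≤ _ := by gcongr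

/-! ### Energy estimates -/

lemma exists_mem_Ioo_of_ae {P : ℝ → Prop} (h : ∀ᵐ t : ℝ, P t) {a b : ℝ} (hab : a < b) :
    ∃ t ∈ Ioo a b, P t := by
  obtain ⟨t, ht, h1⟩ := (Measure.dense_of_ae h).exists_between hab
  exact ⟨t, h1, ht⟩

section Abstract

variable {E : ℝ → ℝ} {D F : ℝ → ℝ≥0∞} {ν κ T Φ : ℝ}

lemma lintegral_Icc_le_two_mul (hF : ∀ t, ∫⁻ τ in Icc t (t + T), F τ ≤ ENNReal.ofReal Φ)
    (hΦ : 0 ≤ Φ) {a b : ℝ} (hab : b ≤ a + 2 * T) :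
    ∫⁻ τ in Icc a b, F τ ≤ ENNReal.ofReal (2 * Φ) := by
  have hsub : Icc a b ⊆ Icc a (a + T) ∪ Icc (a + T) (a + T + T) := by
    intro x hx
    rcases le_total x (a + T) with h | h
    · exact Or.inl ⟨hx.1, h⟩
    · exact Or.inr ⟨h, by linarith [hx.2]⟩
  calc ∫⁻ τ in Icc a b, F τ ≤ ∫⁻ τ in Icc a (a + T) ∪ Icc (a + T) (a + T + T), F τ :=
        lintegral_mono_set hsub
    _ ≤ _ := lintegral_union_le _ _ _
    _ ≤ ENNReal.ofReal Φ + ENNReal.ofReal Φ := add_le_add (hF _) (hF _)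
    _ = _ := by rw [← ENNReal.ofReal_add hΦ hΦ, two_mul]

/-- A bounded complete trajectory that satisfies the energy inequality from almost every initial
time is bounded in terms of the force alone. The least upper bound `M` of the energy is compared
with itself: over a window of length `T` the energy cannot drop much below its final value, so that
the dissipation over this window is at least about `κ² T M`, while the energy inequality bounds it
by about `M`. -/
lemma energy_le (hν : 0 < ν) (hκ : 0 < κ) (hT : 0 < T) (hΦ : 0 ≤ Φ)
    (hEb : BddAbove (range E))
    (hDint : ∀ a b, ∫⁻ τ in Icc a b, D τ < ⊤)
    (hED : ∀ t, ENNReal.ofReal (κ ^ 2 * E t) ≤ D t)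
    (hen : ∀ᵐ s : ℝ, ∀ t, s < t → E t + ν * (∫⁻ τ in Icc s t, D τ).toReal
      ≤ E s + (∫⁻ τ in Icc s t, F τ).toReal / ν)
    (hF : ∀ t, ∫⁻ τ in Icc t (t + T), F τ ≤ ENNReal.ofReal Φ) (t : ℝ) :
    E t ≤ Φ / ν * ((2 + ν * κ ^ 2 * T) / (ν * κ ^ 2 * T)) := by
  set x := ν * κ ^ 2 * T with hx
  have hx0 : 0 < x := by positivity
  have hfin : ∀ {a b : ℝ}, b ≤ a + 2 * T → (∫⁻ τ in Icc a b, F τ).toReal ≤ 2 * Φ := fun h =>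
    ENNReal.toReal_le_of_le_ofReal (by positivity) (lintegral_Icc_le_two_mul hF hΦ h)
  set M := ⨆ t, E t with hM
  have hEM : ∀ t, E t ≤ M := fun t => le_ciSup hEb t
  have step : ∀ t, E t ≤ (M + (2 + x) * (Φ / ν)) / (1 + x) := by
    intro t
    -- the energy inequality need not hold from `t - T` itself, so a good time before it is taken
    obtain ⟨s, hs, hse⟩ := exists_mem_Ioo_of_ae hen (show t - 2 * T < t - T by linarith)
    have h1 := hse t (by linarith [hs.2])
    have h2 : (∫⁻ τ in Icc s t, F τ).toReal / ν ≤ 2 * Φ / ν := by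
      have := hfin (a := s) (b := t) (by linarith [hs.1])
      gcongr
    have h3 : ENNReal.ofReal (κ ^ 2 * (E t - Φ / ν)) * ENNReal.ofReal T
        ≤ ∫⁻ τ in Icc s t, D τ := by
      calc _ = ∫⁻ _ in Ioo (t - T) t, ENNReal.ofReal (κ ^ 2 * (E t - Φ / ν)) := by
            rw [setLIntegral_const, Real.volume_Ioo]; congr 2; ring
        _ ≤ ∫⁻ τ in Ioo (t - T) t, D τ := by
            refine lintegral_mono_ae ((ae_restrict_iff' measurableSet_Ioo).2 ?_)
            filter_upwards [hen] with τ hτ hmem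
            refine le_trans (ENNReal.ofReal_le_ofReal ?_) (hED τ)
            have h4 := hτ t hmem.2
            have h5 : (∫⁻ σ in Icc τ t, F σ).toReal ≤ Φ := by
              refine ENNReal.toReal_le_of_le_ofReal hΦ (le_trans (lintegral_mono_set ?_) (hF τ))
              exact Icc_subset_Icc_right (by linarith [hmem.1])
            have h6 : (∫⁻ σ in Icc τ t, F σ).toReal / ν ≤ Φ / ν := by gcongr
            have h7 : 0 ≤ ν * (∫⁻ σ in Icc τ t, D σ).toReal := by positivity
            gcongr
            linarith
        _ ≤ _ := lintegral_mono_set (Ioo_subset_Icc_self.trans (Icc_subset_Icc_left hs.2.le))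
    have h4 : κ ^ 2 * (E t - Φ / ν) * T ≤ (∫⁻ τ in Icc s t, D τ).toReal := by
      have := ENNReal.toReal_mono (hDint s t).ne h3
      rw [ENNReal.toReal_mul, ENNReal.toReal_ofReal hT.le] at this
      refine le_trans ?_ this
      gcongr
      exact (le_max_left _ _).trans_eq ENNReal.toReal_ofReal'.symm
    have h5 : x * (E t - Φ / ν) ≤ ν * (∫⁻ τ in Icc s t, D τ).toReal := by
      calc x * (E t - Φ / ν) = ν * (κ ^ 2 * (E t - Φ / ν) * T) := by rw [hx]; ring
        _ ≤ _ := by gcongr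
    rw [le_div_iff₀ (by positivity)]
    have h6 := hEM s
    have h7 : 2 * Φ / ν = 2 * (Φ / ν) := by ring
    rw [h7] at h2
    linarith
  have hMle : M ≤ (M + (2 + x) * (Φ / ν)) / (1 + x) := ciSup_le step
  rw [le_div_iff₀ (by positivity)] at hMle
  refine (hEM t).trans ?_
  rw [← mul_div_assoc, le_div_iff₀ hx0]
  linarith

/-- The dissipation over a window, in terms of a bound for the energy and of the force. -/
lemma dissipation_le {M : ℝ} (hν : 0 < ν) (hT : 0 < T) (hΦ : 0 ≤ Φ)
    (hE0 : ∀ t, 0 ≤ E t) (hEM : ∀ t, E t ≤ M)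
    (hDint : ∀ a b, ∫⁻ τ in Icc a b, D τ < ⊤)
    (hen : ∀ᵐ s : ℝ, ∀ t, s < t → E t + ν * (∫⁻ τ in Icc s t, D τ).toReal
      ≤ E s + (∫⁻ τ in Icc s t, F τ).toReal / ν)
    (hF : ∀ t, ∫⁻ τ in Icc t (t + T), F τ ≤ ENNReal.ofReal Φ) (t : ℝ) :
    ν * (∫⁻ τ in Icc t (t + T), D τ).toReal ≤ M + 2 * Φ / ν := by
  obtain ⟨s, hs, hse⟩ := exists_mem_Ioo_of_ae hen (show t - T < t by linarith)
  have h1 := hse (t + T) (by linarith [hs.2])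
  have h2 : (∫⁻ τ in Icc s (t + T), F τ).toReal ≤ 2 * Φ :=
    ENNReal.toReal_le_of_le_ofReal (by positivity)
      (lintegral_Icc_le_two_mul hF hΦ (by linarith [hs.1]))
  have h3 : (∫⁻ τ in Icc t (t + T), D τ).toReal ≤ (∫⁻ τ in Icc s (t + T), D τ).toReal :=
    ENNReal.toReal_mono (hDint _ _).ne (lintegral_mono_set (Icc_subset_Icc_left hs.2.le))
  calc ν * (∫⁻ τ in Icc t (t + T), D τ).toReal
      ≤ ν * (∫⁻ τ in Icc s (t + T), D τ).toReal := by gcongr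
    _ ≤ E s + (∫⁻ τ in Icc s (t + T), F τ).toReal / ν := by linarith [hE0 (t + T)]
    _ ≤ M + 2 * Φ / ν := by
        gcongr
        exact hEM s

end Abstract

/-! ### Complete Leray-Hopf solutions -/

section Complete

variable {ν L : ℝ} {f : ℝ → Freq → C3} {u : ℝ → E3 → E3}

lemma IsCompleteLerayHopf.memLp (hu : IsCompleteLerayHopf ν L f u) (t : ℝ) :
    MemLp (u t) 2 (torusMeasure L) := by
  simpa using (hu (-t)).memLp 0 le_rfl

lemma IsCompleteLerayHopf.fourierCoeff_zero (hu : IsCompleteLerayHopf ν L f u) (t : ℝ) :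
    fourierCoeff L (u t) 0 = 0 :=
  NSE.fourierCoeff_zero (hu.memLp t) (by simpa using (hu (-t)).zero_mean 0 le_rfl)

lemma IsCompleteLerayHopf.continuous_inner (hu : IsCompleteLerayHopf ν L f u) {g : E3 → E3}
    (hg : MemLp g 2 (torusMeasure L)) :
    Continuous fun t => ∫ x, inner ℝ (u t x) (g x) ∂(torusMeasure L) := by
  refine continuous_iff_continuousAt.2 fun t => ?_
  have h := ((hu (1 - t)).weakly_continuous g hg).continuousAt (Ici_mem_nhds zero_lt_one)
  have h2 : ContinuousAt (fun τ : ℝ => τ + (1 - t)) t := by fun_prop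
  have h3 := ContinuousAt.comp (f := fun τ : ℝ => τ + (1 - t)) (x := t)
    (by simpa using h) h2
  simpa [Function.comp_def] using h3

/-- Weak continuity in `L²`, tested with `cos (2πk·x/L) e_j` and `sin (2πk·x/L) e_j`. -/
lemma IsCompleteLerayHopf.continuous_fourierCoeff (hu : IsCompleteLerayHopf ν L f u) (k : Freq) :
    Continuous fun t => fourierCoeff L (u t) k := by
  have key : ∀ j : Fin 3, ∀ c : E3 → ℝ, Continuous c → (∀ x, |c x| ≤ 1) →
      Continuous fun t => ∫ x, u t x j * c x ∂(torusMeasure L) := by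
    intro j c hc hb
    have hg : MemLp (fun x => c x • (EuclideanSpace.single j 1 : E3)) 2 (torusMeasure L) :=
      MemLp.of_bound (hc.smul continuous_const).aestronglyMeasurable 1 (.of_forall fun x => by
        rw [norm_smul]; simpa using hb x)
    refine (hu.continuous_inner hg).congr fun t => integral_congr_ae (.of_forall fun x => ?_)
    simp only [inner_smul_right, EuclideanSpace.inner_single_right]
    simp [mul_comm]
  have hcos : Continuous fun x => Real.cos (phase L k x) :=
    Real.continuous_cos.comp (continuous_phase L k)
  have hsin : Continuous fun x => Real.sin (phase L k x) :=
    Real.continuous_sin.comp (continuous_phase L k)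
  unfold fourierCoeff
  refine (PiLp.continuous_toLp 2 _).comp (continuous_pi fun j => continuous_const.mul ?_)
  have h1 := key j _ hcos fun x => Real.abs_cos_le_one _
  have h2 := key j _ hsin fun x => Real.abs_sin_le_one _
  have h3 : Continuous fun t => ((∫ x, u t x j * Real.cos (phase L k x) ∂(torusMeasure L) : ℝ) : ℂ)
      - ((∫ x, u t x j * Real.sin (phase L k x) ∂(torusMeasure L) : ℝ) : ℂ) * Complex.I := by
    fun_prop
  refine h3.congr fun t => ?_
  have hj : Integrable (fun x => u t x j) (torusMeasure L) :=
    ((EuclideanSpace.proj (𝕜 := ℝ) j : E3 →L[ℝ] ℝ).comp_memLp' (hu.memLp t)).integrable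
      (by norm_num)
  have i1 : Integrable (fun x => u t x j * Real.cos (phase L k x)) (torusMeasure L) :=
    hj.mul_bdd (c := 1) hcos.aestronglyMeasurable (.of_forall fun x => Real.abs_cos_le_one _)
  have i2 : Integrable (fun x => u t x j * Real.sin (phase L k x)) (torusMeasure L) :=
    hj.mul_bdd (c := 1) hsin.aestronglyMeasurable (.of_forall fun x => Real.abs_sin_le_one _)
  rw [← integral_complex_ofReal, ← integral_complex_ofReal, ← integral_mul_const,
    ← integral_sub i1.ofReal (i2.ofReal.mul_const _)]
  refine integral_congr_ae (.of_forall fun x => ?_)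
  simp only
  rw [show -(phase L k x : ℂ) * Complex.I = ((-phase L k x : ℝ) : ℂ) * Complex.I by push_cast; ring,
    Complex.exp_mul_I, ← Complex.ofReal_cos, ← Complex.ofReal_sin, Real.cos_neg, Real.sin_neg]
  push_cast
  ring

lemma IsCompleteLerayHopf.measurable_gradNormSq (hu : IsCompleteLerayHopf ν L f u) :
    Measurable fun t => gradNormSq L (u t) := by
  unfold gradNormSq
  refine Measurable.tsum fun k => ?_
  have := hu.continuous_fourierCoeff k
  exact (by fun_prop : Continuous fun t => L ^ 3 * (2 * Real.pi / L * ‖freqVec k‖) ^ 2 *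
    ‖fourierCoeff L (u t) k‖ ^ 2).measurable.ennreal_ofReal

lemma IsCompleteLerayHopf.lintegral_gradNormSq_lt_top (hu : IsCompleteLerayHopf ν L f u) (a b : ℝ) :
    ∫⁻ τ in Icc a b, gradNormSq L (u τ) < ⊤ := by
  have h := (hu (1 - a)).locally_H1 1 (b + (1 - a)) zero_lt_one
  have hp := (measurePreserving_sub_right volume (1 - a)).setLIntegral_comp_preimage
    (measurableSet_Icc (a := a) (b := b)) hu.measurable_gradNormSq
  have e : (fun x : ℝ => x - (1 - a)) ⁻¹' Icc a b = Icc 1 (b + (1 - a)) := by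
    rw [Set.preimage_sub_const_Icc]; congr 1; ring
  rw [e] at hp
  rwa [← hp]

/-- The energy inequality on the whole line: almost every initial time in `(-n, ∞)` is good for the
translate by `n`, and countably many translates suffice. -/
lemma IsCompleteLerayHopf.energy (hu : IsCompleteLerayHopf ν L f u) :
    ∀ᵐ t₀ : ℝ, ∀ t, t₀ < t → normSq L (u t) / 2 ≤ normSq L (u t₀) / 2
      - ν * (∫ τ in t₀..t, (gradNormSq L (u τ)).toReal) + ∫ τ in t₀..t, pairing L (f τ) (u τ) := by
  have h : ∀ n : ℕ, ∀ᵐ t₀ : ℝ, 0 < t₀ + n → ∀ t, t₀ < t → normSq L (u t) / 2 ≤ normSq L (u t₀) / 2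
      - ν * (∫ τ in t₀..t, (gradNormSq L (u τ)).toReal) + ∫ τ in t₀..t, pairing L (f τ) (u τ) := by
    intro n
    have h1 := (measurePreserving_add_right volume (n : ℝ)).quasiMeasurePreserving.ae (hu n).energy
    filter_upwards [h1] with t₀ h2 h3 t ht
    have h4 := h2 h3 (t + n) (by linarith)
    rw [intervalIntegral.integral_comp_sub_right (fun τ => (gradNormSq L (u τ)).toReal),
      intervalIntegral.integral_comp_sub_right (fun τ => pairing L (f τ) (u τ))] at h4
    simpa using h4
  filter_upwards [ae_all_iff.2 h] with t₀ h1
  obtain ⟨n, hn⟩ := exists_nat_gt (-t₀)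
  exact h1 n (by linarith)

/-- The energy inequality, with the work of the force estimated by Young's inequality. -/
lemma IsCompleteLerayHopf.energy_young (hu : IsCompleteLerayHopf ν L f u) (hL : 0 < L) (hν : 0 < ν)
    (hf0 : ∀ t, f t 0 = 0) (hF : ∀ a b : ℝ, ∫⁻ τ in Icc a b, dualNormSq L (f τ) < ⊤) :
    ∀ᵐ s : ℝ, ∀ t, s < t →
      normSq L (u t) + ν * (∫⁻ τ in Icc s t, gradNormSq L (u τ)).toReal
      ≤ normSq L (u s) + (∫⁻ τ in Icc s t, dualNormSq L (f τ)).toReal / ν := by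
  filter_upwards [hu.energy] with s hs t hst
  have h := hs t hst
  have hD := hu.lintegral_gradNormSq_lt_top s t
  rw [intervalIntegral.integral_of_le hst.le, intervalIntegral.integral_of_le hst.le,
    ← integral_Icc_eq_integral_Ioc, ← integral_Icc_eq_integral_Ioc,
    integral_toReal hu.measurable_gradNormSq.aemeasurable
      (ae_lt_top hu.measurable_gradNormSq hD.ne)] at h
  -- the pairing need not be integrable: the norm of its Bochner integral is at most the lower
  -- integral of its norm in any case
  have h1 : ∫ τ in Icc s t, pairing L (f τ) (u τ)
      ≤ ν / 2 * (∫⁻ τ in Icc s t, gradNormSq L (u τ)).toReal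
        + 1 / (2 * ν) * (∫⁻ τ in Icc s t, dualNormSq L (f τ)).toReal := by
    have h2 : ∫⁻ τ in Icc s t, ‖pairing L (f τ) (u τ)‖ₑ
        ≤ ENNReal.ofReal (ν / 2) * (∫⁻ τ in Icc s t, gradNormSq L (u τ))
          + ENNReal.ofReal (1 / (2 * ν)) * (∫⁻ τ in Icc s t, dualNormSq L (f τ)) := by
      rw [← lintegral_const_mul _ hu.measurable_gradNormSq,
        ← lintegral_const_mul' _ _ ENNReal.ofReal_ne_top,
        ← lintegral_add_left (hu.measurable_gradNormSq.const_mul _)]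
      exact lintegral_mono fun τ => enorm_pairing_le hL hν (hf0 τ) _
    have h3 : ENNReal.ofReal (ν / 2) * (∫⁻ τ in Icc s t, gradNormSq L (u τ)) ≠ ⊤ :=
      ENNReal.mul_ne_top ENNReal.ofReal_ne_top hD.ne
    have h4 : ENNReal.ofReal (1 / (2 * ν)) * (∫⁻ τ in Icc s t, dualNormSq L (f τ)) ≠ ⊤ :=
      ENNReal.mul_ne_top ENNReal.ofReal_ne_top (hF s t).ne
    have h5 := ENNReal.toReal_mono (ENNReal.add_ne_top.2 ⟨h3, h4⟩) h2
    rw [ENNReal.toReal_add h3 h4, ENNReal.toReal_mul, ENNReal.toReal_mul,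
      ENNReal.toReal_ofReal (by positivity), ENNReal.toReal_ofReal (by positivity)] at h5
    refine le_trans (le_trans (Real.le_norm_self _) ?_) h5
    refine (norm_integral_le_lintegral_norm _).trans (le_of_eq ?_)
    simp only [ofReal_norm]
  have e : (∫⁻ τ in Icc s t, dualNormSq L (f τ)).toReal / ν
      = 2 * (1 / (2 * ν) * (∫⁻ τ in Icc s t, dualNormSq L (f τ)).toReal) := by field_simp
  rw [e]
  linarith

lemma normSq_nonneg (L : ℝ) (v : E3 → E3) : 0 ≤ normSq L v :=
  integral_nonneg fun _ => by positivity

lemma IsCompleteLerayHopf.bddAbove_normSq (hu : IsCompleteLerayHopf ν L f u)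
    (hb : IsBoundedL2 L u) : BddAbove (range fun t => normSq L (u t)) := by
  obtain ⟨M, hM⟩ := hb
  refine ⟨(M : ℝ) ^ 2, ?_⟩
  rintro _ ⟨t, rfl⟩
  have h := (hu.memLp t).eLpNorm_eq_integral_rpow_norm (by norm_num) (by norm_num)
  have h1 := hM t
  rw [h] at h1
  have h2 : (normSq L (u t)) ^ (1 / 2 : ℝ) ≤ M := by
    have : ENNReal.ofReal ((normSq L (u t)) ^ (1 / 2 : ℝ)) ≤ M := by
      simpa [normSq] using h1
    have h3 := ENNReal.toReal_mono ENNReal.coe_ne_top this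
    rwa [ENNReal.toReal_ofReal (Real.rpow_nonneg (normSq_nonneg _ _) _)] at h3
  rw [← Real.sqrt_eq_rpow] at h2
  exact (Real.sqrt_le_left M.2).1 h2

lemma IsCompleteLerayHopf.poincare (hu : IsCompleteLerayHopf ν L f u) (hL : 0 < L) (t : ℝ) :
    ENNReal.ofReal (kappa0 L ^ 2 * normSq L (u t)) ≤ gradNormSq L (u t) :=
  NSE.poincare hL (hu.memLp t) (hu.fourierCoeff_zero t)

end Complete

/-! ### The Grashof number bounds the dissipation -/

lemma kappa0_pos {L : ℝ} (hL : 0 < L) : 0 < kappa0 L := by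
  unfold kappa0; positivity

lemma lam_zero_le_kappa0 {L : ℝ} (hL : 0 < L) : lam L 0 ≤ kappa0 L := by
  unfold lam kappa0
  rw [zpow_zero]
  gcongr
  linarith [Real.pi_gt_three]

/-- A bound of the mean dissipation, rewritten as a bound of Kolmogorov's wavenumber. -/
lemma kolmogorovWavenumber_le_grashofBound {L ν T d G : ℝ} (hL : 0 < L) (hν : 0 < ν) (hT : 0 < T)
    (hd : 0 < d) (hG : 0 ≤ G) {u : ℝ → E3 → E3} {t : ℝ}
    (h : (timeAvg T (fun τ => gradNormSq L (u τ)) t).toReal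
      ≤ kappa0 L * ν ^ 2 * G ^ 2 * (1 / (ν * T * kappa0 L ^ 2) + 1)) :
    kolmogorovWavenumber L ν T d u t ≤ grashofBound L ν T d G := by
  have hκ := kappa0_pos hL
  have hlam := lam_pos hL 0
  unfold kolmogorovWavenumber dissipationRate grashofBound
  set D := (timeAvg T (fun τ => gradNormSq L (u τ)) t).toReal with hD
  have hD0 : 0 ≤ D := ENNReal.toReal_nonneg
  set R := 1 / (ν * T * kappa0 L ^ 2) + 1 with hR
  have hR0 : 0 < R := by positivity
  have h1 : lam L 0 ^ d * ν * D / ν ^ 3 ≤ kappa0 L ^ (d + 1) * G ^ 2 * R := by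
    calc lam L 0 ^ d * ν * D / ν ^ 3 = lam L 0 ^ d * D / ν ^ 2 := by field_simp
      _ ≤ kappa0 L ^ d * (kappa0 L * ν ^ 2 * G ^ 2 * R) / ν ^ 2 := by
          gcongr
          exact lam_zero_le_kappa0 hL
      _ = kappa0 L ^ (d + 1) * G ^ 2 * R := by
          rw [Real.rpow_add hκ, Real.rpow_one]; field_simp
  have h2 := Real.rpow_le_rpow (by positivity) h1 (by positivity : 0 ≤ 1 / (d + 1))
  refine h2.trans (le_of_eq ?_)
  rw [Real.mul_rpow (by positivity) hR0.le, Real.mul_rpow (by positivity) (by positivity),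
    ← Real.rpow_mul hκ.le, ← Real.rpow_natCast, ← Real.rpow_mul hG,
    mul_one_div_cancel (by positivity), Real.rpow_one]
  congr 3
  push_cast
  ring

section Force

variable {χ : E3 → ℝ} {L : ℝ} {f : ℝ → Freq → C3}

/-- Translational boundedness in `L²_loc` does not depend on the length of the window. -/
lemma IsForce.iSup_lintegral_lt_top (hf : IsForce χ L f) (T : ℝ) :
    (⨆ t : ℝ, ∫⁻ τ in Icc t (t + T), sobolevNorm χ L (-1) (f τ) ^ 2) < ⊤ := by
  set B := ⨆ t : ℝ, ∫⁻ τ in Icc t (t + 1), sobolevNorm χ L (-1) (f τ) ^ 2 with hB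
  have h : ∀ (n : ℕ) (t : ℝ), ∫⁻ τ in Icc t (t + n), sobolevNorm χ L (-1) (f τ) ^ 2 ≤ n * B := by
    intro n
    induction n with
    | zero => intro t; simp
    | succ n ih =>
      intro t
      have hsub : Icc t (t + (n + 1 : ℕ)) ⊆ Icc t (t + n) ∪ Icc (t + n) (t + n + 1) := by
        intro x hx
        have := hx.2
        push_cast at this
        rcases le_total x (t + n) with h | h
        · exact Or.inl ⟨hx.1, h⟩
        · exact Or.inr ⟨h, by linarith⟩
      refine (lintegral_mono_set hsub).trans ((lintegral_union_le _ _ _).trans ?_)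
      push_cast
      rw [add_mul, one_mul]
      exact add_le_add (ih t) (le_iSup (fun t : ℝ =>
        ∫⁻ τ in Icc t (t + 1), sobolevNorm χ L (-1) (f τ) ^ 2) (t + n))
  obtain ⟨n, hn⟩ := exists_nat_ge T
  refine (iSup_le fun t => (lintegral_mono_set ?_).trans (h n t)).trans_lt
    (ENNReal.mul_lt_top (ENNReal.natCast_lt_top n) hf.bounded)
  exact Icc_subset_Icc_right (by linarith)

lemma forceNorm_sq (T : ℝ) : forceNorm χ L T f ^ 2
    = (⨆ t : ℝ, timeAvg T (fun τ => sobolevNorm χ L (-1) (f τ) ^ 2) t).toReal :=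
  Real.sq_sqrt ENNReal.toReal_nonneg

lemma IsForce.lintegral_dualNormSq_le (hχ : IsCutoff χ) (hf : IsForce χ L f) (hL : 0 < L) {T : ℝ}
    (hT : 0 < T) (t : ℝ) :
    ∫⁻ τ in Icc t (t + T), dualNormSq L (f τ)
      ≤ ENNReal.ofReal (T / 10 * forceNorm χ L T f ^ 2) := by
  have hT' : ENNReal.ofReal T ≠ 0 := by simpa using hT
  set S := ⨆ t : ℝ, timeAvg T (fun τ => sobolevNorm χ L (-1) (f τ) ^ 2) t with hS
  have hSfin : S ≠ ⊤ := by
    have : S = (ENNReal.ofReal T)⁻¹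
        * ⨆ t : ℝ, ∫⁻ τ in Icc t (t + T), sobolevNorm χ L (-1) (f τ) ^ 2 := by
      rw [ENNReal.mul_iSup]; rfl
    rw [this]
    exact ENNReal.mul_ne_top (ENNReal.inv_ne_top.2 hT') (hf.iSup_lintegral_lt_top T).ne
  have h1 : ∫⁻ τ in Icc t (t + T), sobolevNorm χ L (-1) (f τ) ^ 2 ≤ ENNReal.ofReal T * S := by
    have h2 : timeAvg T (fun τ => sobolevNorm χ L (-1) (f τ) ^ 2) t ≤ S :=
      le_iSup (fun t => timeAvg T (fun τ => sobolevNorm χ L (-1) (f τ) ^ 2) t) t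
    unfold timeAvg at h2
    rwa [ENNReal.inv_mul_le_iff hT' ENNReal.ofReal_ne_top] at h2
  have h3 : ENNReal.ofReal 10 * ∫⁻ τ in Icc t (t + T), dualNormSq L (f τ)
      ≤ ENNReal.ofReal (T * forceNorm χ L T f ^ 2) := by
    rw [← lintegral_const_mul' _ _ ENNReal.ofReal_ne_top, forceNorm_sq, ENNReal.ofReal_mul hT.le,
      ENNReal.ofReal_toReal hSfin]
    exact (lintegral_mono fun τ => hχ.ten_mul_dualNormSq_le hL (f τ)).trans h1
  have h4 : ENNReal.ofReal (T * forceNorm χ L T f ^ 2)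
      = ENNReal.ofReal 10 * ENNReal.ofReal (T / 10 * forceNorm χ L T f ^ 2) := by
    rw [← ENNReal.ofReal_mul (by norm_num)]; congr 1; ring
  rw [h4] at h3
  exact (ENNReal.mul_le_mul_iff_right (by simp) ENNReal.ofReal_ne_top).1 h3

lemma IsForce.lintegral_dualNormSq_lt_top (hχ : IsCutoff χ) (hf : IsForce χ L f) (hL : 0 < L)
    (a b : ℝ) : ∫⁻ τ in Icc a b, dualNormSq L (f τ) < ⊤ := by
  have h := hf.lintegral_dualNormSq_le hχ hL (T := |b - a| + 1) (by positivity) a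
  refine (lintegral_mono_set (Icc_subset_Icc_right ?_)).trans_lt (h.trans_lt ENNReal.ofReal_lt_top)
  linarith [le_abs_self (b - a)]

end Force

lemma toReal_timeAvg {T : ℝ} (hT : 0 < T) (g : ℝ → ℝ≥0∞) (t : ℝ) :
    (timeAvg T g t).toReal = (∫⁻ τ in Icc t (t + T), g τ).toReal / T := by
  rw [timeAvg, ENNReal.toReal_mul, ENNReal.toReal_inv, ENNReal.toReal_ofReal hT.le, div_eq_inv_mul]

section Grashof

variable {χ : E3 → ℝ} {ν L T : ℝ} {f : ℝ → Freq → C3} {u : ℝ → E3 → E3}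

lemma grashof_nonneg (hL : 0 < L) (hν : 0 < ν) (hT : 0 < T) : 0 ≤ grashof χ L ν T f := by
  have hκ := kappa0_pos hL
  have he : 0 ≤ 1 - Real.exp (-(ν * kappa0 L ^ 2 * T)) :=
    sub_nonneg.2 (Real.exp_le_one_iff.2 (neg_nonpos.2 (by positivity)))
  have hf : 0 ≤ forceNorm χ L T f := Real.sqrt_nonneg _
  unfold grashof
  positivity

lemma grashofAutonomous_nonneg {F : Freq → C3} (hL : 0 < L) : 0 ≤ grashofAutonomous χ L ν F := by
  have hκ := kappa0_pos hL
  unfold grashofAutonomous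
  positivity

/-- The mean dissipation is bounded by the Grashof number of a time-dependent force. -/
lemma dissipation_le_grashof (hχ : IsCutoff χ) (hL : 0 < L) (hν : 0 < ν) (hT : 0 < T)
    (hf : IsForce χ L f) (hu : IsCompleteLerayHopf ν L f u) (hb : IsBoundedL2 L u) (t : ℝ) :
    (timeAvg T (fun τ => gradNormSq L (u τ)) t).toReal
      ≤ kappa0 L * ν ^ 2 * grashof χ L ν T f ^ 2 * (1 / (ν * T * kappa0 L ^ 2) + 1) := by
  have hκ := kappa0_pos hL
  have hen := hu.energy_young hL hν hf.zero_mean (hf.lintegral_dualNormSq_lt_top hχ hL)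
  have hF := hf.lintegral_dualNormSq_le hχ hL hT
  set b := forceNorm χ L T f with hb'
  have hEM := energy_le hν hκ hT (by positivity) (hu.bddAbove_normSq hb)
    hu.lintegral_gradNormSq_lt_top (hu.poincare hL) hen hF
  have hdis := dissipation_le hν hT (by positivity) (fun t => normSq_nonneg L (u t)) hEM
    hu.lintegral_gradNormSq_lt_top hen hF t
  rw [toReal_timeAvg hT]
  set D := (∫⁻ τ in Icc t (t + T), gradNormSq L (u τ)).toReal with hD
  set κ := kappa0 L with hκd
  have hx0 : 0 < ν * κ ^ 2 * T := by positivity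
  have hG : grashof χ L ν T f ^ 2
      = T * κ * b ^ 2 / (ν ^ 3 * (1 - Real.exp (-(ν * κ ^ 2 * T)))) := by
    unfold grashof
    have he : 0 ≤ 1 - Real.exp (-(ν * κ ^ 2 * T)) := by
      have : Real.exp (-(ν * κ ^ 2 * T)) ≤ 1 := Real.exp_le_one_iff.2 (by linarith)
      linarith
    have hs : ∀ y : ℝ, 0 ≤ y → (y ^ (1 / 2 : ℝ)) ^ 2 = y := fun y hy => by
      rw [← Real.sqrt_eq_rpow, Real.sq_sqrt hy]
    rw [div_pow, mul_pow, mul_pow, mul_pow, hs _ hT.le, hs _ hκ.le, hs _ he,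
      ← Real.rpow_natCast (ν ^ (3 / 2 : ℝ)), ← Real.rpow_mul hν.le]
    norm_num
    rfl
  rw [hG]
  set x := ν * κ ^ 2 * T with hx
  -- the elementary bounds `e ≤ 1` and `e ≤ x` for `e = 1 - exp (-x)`
  set e := 1 - Real.exp (-x) with he
  have he0 : 0 < e := by
    have : Real.exp (-x) < 1 := Real.exp_zero ▸ Real.exp_lt_exp.2 (by linarith)
    linarith
  have he1 : e ≤ 1 := by linarith [Real.exp_pos (-x)]
  have hex : e ≤ x := by linarith [Real.add_one_le_exp (-x)]
  have h1 : D / T ≤ b ^ 2 / (10 * ν ^ 2) * ((2 + 3 * x) / x) := by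
    rw [div_le_iff₀ hT, ← mul_le_mul_iff_right₀ hν]
    refine hdis.trans (le_of_eq ?_)
    field_simp
    ring
  refine h1.trans ?_
  -- `e (2 + 3x) ≤ 5x`, which the factor `10` from the comparison of the `H⁻¹` norms absorbs
  have h2 : (2 + 3 * x) / x ≤ 10 * ((1 + x) / (e * x) * x) := by
    have : (1 + x) / (e * x) * x = (1 + x) / e := by field_simp
    rw [this, ← mul_div_assoc, div_le_div_iff₀ hx0 he0]
    nlinarith
  calc b ^ 2 / (10 * ν ^ 2) * ((2 + 3 * x) / x)
      ≤ b ^ 2 / (10 * ν ^ 2) * (10 * ((1 + x) / (e * x) * x)) := by gcongr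
    _ = _ := by
        have : ν * T * κ ^ 2 = x := by rw [hx]; ring
        rw [this]
        have h3 : T = x / (ν * κ ^ 2) := by rw [hx]; field_simp
        rw [h3]
        field_simp

/-- The mean dissipation is bounded by the Grashof number of a time-independent force. -/
lemma dissipation_le_grashofAutonomous {F : Freq → C3} (hχ : IsCutoff χ) (hL : 0 < L) (hν : 0 < ν)
    (hT : 0 < T) (hf : IsForce χ L (fun _ => F)) (hu : IsCompleteLerayHopf ν L (fun _ => F) u)
    (hb : IsBoundedL2 L u) (t : ℝ) :
    (timeAvg T (fun τ => gradNormSq L (u τ)) t).toReal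
      ≤ kappa0 L * ν ^ 2 * grashofAutonomous χ L ν F ^ 2 * (1 / (ν * T * kappa0 L ^ 2) + 1) := by
  have hκ := kappa0_pos hL
  have hen := hu.energy_young hL hν hf.zero_mean (hf.lintegral_dualNormSq_lt_top hχ hL)
  have hfin : sobolevNorm χ L (-1) F ^ 2 < ⊤ := by
    have h := (le_iSup (fun t : ℝ => ∫⁻ τ in Icc t (t + 1), sobolevNorm χ L (-1) F ^ 2) 0).trans_lt
      hf.bounded
    simpa using h
  set b := (sobolevNorm χ L (-1) F).toReal with hb'
  have hdual : dualNormSq L F ≤ ENNReal.ofReal (b ^ 2 / 10) := by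
    have h1 := hχ.ten_mul_dualNormSq_le hL F
    have h2 : sobolevNorm χ L (-1) F ^ 2 = ENNReal.ofReal 10 * ENNReal.ofReal (b ^ 2 / 10) := by
      rw [← ENNReal.ofReal_mul (by norm_num), mul_div_cancel₀ _ (by norm_num : (10 : ℝ) ≠ 0), hb',
        ← ENNReal.toReal_pow, ENNReal.ofReal_toReal hfin.ne]
    rw [h2] at h1
    exact (ENNReal.mul_le_mul_iff_right (by simp) ENNReal.ofReal_ne_top).1 h1
  have hF : ∀ S : ℝ, 0 < S → ∀ t, ∫⁻ _ in Icc t (t + S), dualNormSq L F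
      ≤ ENNReal.ofReal (S * (b ^ 2 / 10)) := fun S hS t => by
    rw [setLIntegral_const, Real.volume_Icc, add_sub_cancel_left, ENNReal.ofReal_mul hS.le,
      mul_comm]
    gcongr
  set κ := kappa0 L with hκd
  -- for a constant force the energy bound may be taken on a window of the natural length `1/(νκ²)`
  have hS : 0 < 1 / (ν * κ ^ 2) := by positivity
  have hEM := energy_le hν hκ hS (by positivity) (hu.bddAbove_normSq hb)
    hu.lintegral_gradNormSq_lt_top (hu.poincare hL) hen (hF _ hS)
  have hdis := dissipation_le hν hT (by positivity) (fun t => normSq_nonneg L (u t)) hEM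
    hu.lintegral_gradNormSq_lt_top hen (hF _ hT) t
  rw [toReal_timeAvg hT]
  set D := (∫⁻ τ in Icc t (t + T), gradNormSq L (u τ)).toReal with hD
  have hG : grashofAutonomous χ L ν F ^ 2 = b ^ 2 / (ν ^ 4 * κ) := by
    unfold grashofAutonomous
    rw [div_pow, mul_pow, ← Real.sqrt_eq_rpow, Real.sq_sqrt hκ.le]
    ring
  rw [hG]
  have h1 : D / T ≤ b ^ 2 / (10 * ν ^ 2) * (3 / (ν * T * κ ^ 2) + 2) := by
    rw [div_le_iff₀ hT, ← mul_le_mul_iff_right₀ hν]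
    refine hdis.trans (le_of_eq ?_)
    field_simp
    ring
  refine h1.trans ?_
  calc b ^ 2 / (10 * ν ^ 2) * (3 / (ν * T * κ ^ 2) + 2)
      ≤ b ^ 2 / (10 * ν ^ 2) * (10 * (1 / (ν * T * κ ^ 2) + 1)) := by
        gcongr
        have : 0 < 1 / (ν * T * κ ^ 2) := by positivity
        have e : 3 / (ν * T * κ ^ 2) = 3 * (1 / (ν * T * κ ^ 2)) := by ring
        linarith
    _ = _ := by field_simp

end Grashof

/-! ### Measurability of the determining wavenumber -/

section Measurability

variable {χ : E3 → ℝ} {L : ℝ} {a : ℝ → Freq → C3}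

lemma IsCutoff.measurable_blockNorm_top (hχ : IsCutoff χ) (hL : 0 < L)
    (ha : ∀ k, Continuous fun t => a t k) (q : ℤ) :
    Measurable fun t => blockNorm χ L ⊤ (a t) q := by
  unfold blockNorm
  simp_rw [fun t => eLpNorm_top_eq_iSup hL (hχ.contDiff_lpBlock L (a t) q).continuous
    (isPeriodic_lpBlock hL (a t) q), hχ.lpBlock_eq_sum]
  refine Measurable.iSup fun n => ?_
  refine (Continuous.enorm ?_).measurable
  refine continuous_finsetSum _ fun k _ => ?_
  have := ha k
  fun_prop

lemma IsCutoff.measurable_eLpNorm_gradAbs_lpLow (hχ : IsCutoff χ) (hL : 0 < L)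
    (ha : ∀ k, Continuous fun t => a t k) (q : ℤ) :
    Measurable fun t => eLpNorm (gradAbs (lpLow χ L (a t) q)) ⊤ (torusMeasure L) := by
  simp_rw [fun t => eLpNorm_top_eq_iSup hL (continuous_gradAbs (hχ.contDiff_lpLow L (a t) q))
    (isPeriodic_gradAbs (isPeriodic_lpLow hL (a t) q))]
  refine Measurable.iSup fun n => ?_
  refine (Continuous.enorm ?_).measurable
  simp only [gradAbs, hχ.fderiv_lpLow, hχ.fderiv_lpBlock]
  refine Real.continuous_sqrt.comp (continuous_finsetSum _ fun i _ => (Continuous.norm ?_).pow 2)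
  refine continuous_finsetSum _ fun p _ => continuous_finsetSum _ fun k _ => ?_
  have := ha k
  fun_prop

lemma IsCutoff.measurable_detWavenumber (hχ : IsCutoff χ) (hL : 0 < L) (ν c₀ δ : ℝ)
    {u : ℝ → E3 → E3} (hu : ∀ k, Continuous fun t => fourierCoeff L (u t) k) :
    Measurable fun t => detWavenumber χ L ν c₀ δ (u t) := by
  classical
  have hset : ∀ q : ℕ, MeasurableSet {t | IsDetermining χ L ν c₀ δ (u t) q} := by
    intro q
    unfold IsDetermining
    refine MeasurableSet.inter ?_ ?_
    · change MeasurableSet {t | ∀ p : ℕ, q < p → _}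
      simp only [Set.ofPred_forall]
      refine MeasurableSet.iInter fun p => MeasurableSet.iInter fun _ => ?_
      exact measurableSet_lt ((hχ.measurable_blockNorm_top hL hu p).const_mul _) measurable_const
    · exact measurableSet_lt ((hχ.measurable_eLpNorm_gradAbs_lpLow hL hu q).const_mul _)
        measurable_const
  have e : (fun t => detWavenumber χ L ν c₀ δ (u t)) = fun t => ⨅ q : ℕ,
      {t | IsDetermining χ L ν c₀ δ (u t) q}.piecewise (fun _ => ENNReal.ofReal (lam L q))
        (fun _ => ⊤) t := by
    funext t
    refine le_antisymm (le_iInf fun q => ?_) (le_sInf ?_)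
    · by_cases h : IsDetermining χ L ν c₀ δ (u t) q
      · rw [piecewise_eq_of_mem _ _ _ (by exact h)]
        exact sInf_le ⟨q, h, rfl⟩
      · rw [piecewise_eq_of_notMem _ _ _ (by exact h)]
        exact le_top
    · rintro _ ⟨q, hq, rfl⟩
      refine (iInf_le _ q).trans (le_of_eq ?_)
      rw [piecewise_eq_of_mem _ _ _ (by exact hq)]
  rw [e]
  exact Measurable.iInf fun q => Measurable.piecewise (hset q) measurable_const measurable_const

end Measurability

/-! ### The pointwise bound of the determining wavenumber -/

section Pointwise

/-- `∑_q λ_q^{-1+s} ‖u_q‖_{L^∞}²`, the quantity that defines the intermittency dimension. -/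
def supSquareSum (χ : E3 → ℝ) (L s : ℝ) (a : Freq → C3) : ℝ≥0∞ :=
  ∑' n : ℕ, ENNReal.ofReal (lam L (n - 1) ^ (-1 + s)) * blockNorm χ L ⊤ a (n - 1) ^ 2

lemma lam_eq_mul (L : ℝ) (p q : ℤ) : lam L p = lam L q * 2 ^ (p - q) := by
  rw [lam, lam, div_mul_eq_mul_div, ← zpow_add₀ (by norm_num), add_sub_cancel]

/-- The sum `∑_{-1 ≤ p ≤ q} λ_p^s` is geometric, hence comparable to its last term. -/
lemma sum_lam_rpow_le {L s : ℝ} (hL : 0 < L) (hs : 0 < s) (q : ℕ) :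
    ∑ n ∈ Finset.range (q + 2), lam L (n - 1) ^ s ≤ lam L q ^ s * (1 - (2 : ℝ) ^ (-s))⁻¹ := by
  have hr1 : (2 : ℝ) ^ (-s) < 1 := Real.rpow_lt_one_of_one_lt_of_neg (by norm_num) (by linarith)
  have e : ∀ j ∈ Finset.range (q + 2),
      lam L (((q + 2 - 1 - j : ℕ) : ℤ) - 1) ^ s = lam L q ^ s * ((2 : ℝ) ^ (-s)) ^ j := by
    intro j hj
    have hj' := Finset.mem_range.1 hj
    rw [lam_eq_mul L _ q, Real.mul_rpow (lam_pos hL _).le (by positivity)]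
    congr 1
    have : (((q + 2 - 1 - j : ℕ) : ℤ) - 1 - q) = -(j : ℤ) := by lia
    rw [this, ← Real.rpow_intCast, ← Real.rpow_natCast, ← Real.rpow_mul (by norm_num),
      ← Real.rpow_mul (by norm_num)]
    congr 1
    push_cast
    ring
  rw [← Finset.sum_range_reflect, Finset.sum_congr rfl e, ← Finset.mul_sum]
  gcongr
  · exact Real.rpow_nonneg (lam_pos hL _).le _
  · rw [← tsum_geometric_of_lt_one (by positivity) hr1]
    exact (summable_geometric_of_lt_one (by positivity) hr1).sum_le_tsum _ fun _ _ => by positivity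

lemma sum_Icc_neg_one {M : Type*} [AddCommMonoid M] (g : ℤ → M) (q : ℕ) :
    ∑ p ∈ Finset.Icc (-1 : ℤ) q, g p = ∑ n ∈ Finset.range (q + 2), g (n - 1) := by
  refine (Finset.sum_nbij' (fun n : ℕ => (n : ℤ) - 1) (fun p : ℤ => (p + 1).toNat)
    ?_ ?_ ?_ ?_ ?_).symm
  all_goals intro n hn; simp only [Finset.mem_Icc, Finset.mem_range] at *
  all_goals lia

/-- The constant in the pointwise bound of the determining wavenumber. -/
def wavenumberConst (d : ℝ) : ℝ :=
  1 + (12 * Real.pi * Real.exp 1) ^ 2 * (1 - (2 : ℝ) ^ (-(3 - d)))⁻¹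

lemma one_le_wavenumberConst {d : ℝ} (hd : d < 3) : 1 ≤ wavenumberConst d := by
  have : (2 : ℝ) ^ (-(3 - d)) < 1 :=
    Real.rpow_lt_one_of_one_lt_of_neg (by norm_num) (by linarith)
  have : 0 < (1 - (2 : ℝ) ^ (-(3 - d)))⁻¹ := inv_pos.2 (by linarith)
  unfold wavenumberConst
  have : 0 ≤ (12 * Real.pi * Real.exp 1) ^ 2 * (1 - (2 : ℝ) ^ (-(3 - d)))⁻¹ := by positivity
  linarith

variable {χ : E3 → ℝ} {L ν c₀ δ d : ℝ} {v : E3 → E3}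

/-- Failure of the condition on the high modes: a single block is large. -/
lemma lam_rpow_le_of_high (hL : 0 < L) (hδd : δ ≤ d) {q p : ℕ} (hqp : q < p)
    (h : ENNReal.ofReal (c₀ * ν) ≤
      ENNReal.ofReal ((L * lam L ((p : ℤ) - q)) ^ ((δ - 1) / 2) * (lam L q)⁻¹)
        * blockNorm χ L ⊤ (fourierCoeff L v) p) :
    ENNReal.ofReal (lam L q ^ (d + 1)) * ENNReal.ofReal (c₀ * ν) ^ 2
      ≤ supSquareSum χ L d (fourierCoeff L v) := by
  set b := blockNorm χ L ⊤ (fourierCoeff L v) p with hb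
  set y := (L * lam L ((p : ℤ) - q)) ^ ((δ - 1) / 2) * (lam L q)⁻¹ with hy
  have hl := lam_pos hL q
  have hreal : lam L q ^ (d + 1) * y ^ 2 ≤ lam L p ^ (-1 + d) := by
    set r : ℝ := 2 ^ ((p : ℤ) - q) with hr
    have hr1 : 1 ≤ r := one_le_zpow₀ (by norm_num) (by lia)
    have e1 : L * lam L ((p : ℤ) - q) = r := by
      unfold lam; field_simp; rfl
    have e2 : y ^ 2 = r ^ (δ - 1) * (lam L q ^ 2)⁻¹ := by
      rw [hy, e1, mul_pow, inv_pow, ← Real.rpow_natCast, ← Real.rpow_mul (by positivity)]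
      congr 2
      push_cast; ring
    have e3 : lam L q ^ (d + 1) = lam L q ^ (-1 + d) * lam L q ^ 2 := by
      rw [← Real.rpow_natCast, ← Real.rpow_add hl]
      congr 1
      push_cast; ring
    rw [e2, e3, lam_eq_mul L p q, Real.mul_rpow hl.le (by positivity)]
    calc _ = lam L q ^ (-1 + d) * r ^ (δ - 1) := by field_simp
      _ ≤ _ := by
          gcongr _ * ?_
          exact Real.rpow_le_rpow_of_exponent_le hr1 (by linarith)
  calc _ ≤ ENNReal.ofReal (lam L q ^ (d + 1)) * (ENNReal.ofReal y * b) ^ 2 := by gcongr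
    _ = ENNReal.ofReal (lam L q ^ (d + 1) * y ^ 2) * b ^ 2 := by
        have hy0 : 0 ≤ y := mul_nonneg (Real.rpow_nonneg (mul_nonneg hL.le (lam_pos hL _).le) _)
          (inv_nonneg.2 hl.le)
        rw [mul_pow, ← mul_assoc, ENNReal.ofReal_mul (Real.rpow_nonneg hl.le _),
          ENNReal.ofReal_pow hy0]
    _ ≤ ENNReal.ofReal (lam L p ^ (-1 + d)) * b ^ 2 := by gcongr
    _ ≤ _ := by
        have := ENNReal.le_tsum (f := fun n : ℕ => ENNReal.ofReal (lam L (n - 1) ^ (-1 + d))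
          * blockNorm χ L ⊤ (fourierCoeff L v) (n - 1) ^ 2) (p + 1)
        simpa [supSquareSum] using this

/-- Failure of the condition on the low modes: since `d < 3`, the bound
`‖∇u_{≤ q}‖_∞ ≲ ∑_{p ≤ q} λ_p ‖u_p‖_∞` and the Cauchy-Schwarz inequality with the weights
`λ_p^{(3-d)/2}` and `λ_p^{(d-1)/2}` apply. -/
lemma IsCutoff.lam_rpow_le_of_low (hχ : IsCutoff χ) (hL : 0 < L) (hν : 0 < ν) (hc₀ : 0 < c₀)
    (hd : d < 3) {q : ℕ}
    (h : ENNReal.ofReal (c₀ * ν) ≤ ENNReal.ofReal ((lam L q ^ 2)⁻¹)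
      * eLpNorm (gradAbs (lpLow χ L (fourierCoeff L v) q)) ⊤ (torusMeasure L)) :
    ENNReal.ofReal (lam L q ^ (d + 1)) * ENNReal.ofReal (c₀ * ν) ^ 2
      ≤ ENNReal.ofReal (wavenumberConst d) * supSquareSum χ L d (fourierCoeff L v) := by
  set β : ℕ → ℝ := fun n => (blockNorm χ L ⊤ (fourierCoeff L v) (n - 1)).toReal with hβ
  have hβ0 : ∀ n, 0 ≤ β n := fun n => ENNReal.toReal_nonneg
  set A := 12 * Real.pi * Real.exp 1 with hA
  have hA0 : 0 < A := by positivity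
  have hl := lam_pos hL q
  have hlam : ∀ n : ℕ, 0 < lam L (n - 1) := fun n => lam_pos hL _
  set K := (1 - (2 : ℝ) ^ (-(3 - d)))⁻¹ with hK
  have h1 : c₀ * ν ≤ (lam L q ^ 2)⁻¹ * (A * ∑ n ∈ Finset.range (q + 2), lam L (n - 1) * β n) := by
    have h2 := h.trans (mul_le_mul_right (hχ.eLpNorm_gradAbs_lpLow_le hL (fourierCoeff L v) q) _)
    rw [sum_Icc_neg_one, ← ENNReal.ofReal_mul (by positivity)] at h2
    refine (ENNReal.ofReal_le_ofReal_iff ?_).1 h2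
    have : 0 ≤ ∑ n ∈ Finset.range (q + 2), lam L (n - 1) * β n :=
      Finset.sum_nonneg fun n _ => mul_nonneg (hlam n).le (hβ0 n)
    positivity
  have h3 : (∑ n ∈ Finset.range (q + 2), lam L (n - 1) * β n) ^ 2
      ≤ (lam L q ^ (3 - d) * K) *
        ∑ n ∈ Finset.range (q + 2), lam L (n - 1) ^ (-1 + d) * β n ^ 2 := by
    have hcs := Finset.sum_mul_sq_le_sq_mul_sq (Finset.range (q + 2))
      (fun n : ℕ => lam L (n - 1) ^ ((3 - d) / 2))
      (fun n : ℕ => lam L (n - 1) ^ ((-1 + d) / 2) * β n)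
    have e1 : ∀ n : ℕ, lam L (n - 1) ^ ((3 - d) / 2) * (lam L (n - 1) ^ ((-1 + d) / 2) * β n)
        = lam L (n - 1) * β n := fun n => by
      rw [← mul_assoc, ← Real.rpow_add (hlam n), show (3 - d) / 2 + (-1 + d) / 2 = 1 by ring,
        Real.rpow_one]
    have e2 : ∀ (n : ℕ) (s : ℝ), (lam L (n - 1) ^ (s / 2)) ^ 2 = lam L (n - 1) ^ s := fun n s => by
      rw [← Real.rpow_natCast, ← Real.rpow_mul (hlam n).le]
      congr 1
      push_cast; ring
    simp only [e1, mul_pow, e2] at hcs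
    refine hcs.trans ?_
    gcongr
    · exact Finset.sum_nonneg fun n _ => mul_nonneg (Real.rpow_nonneg (hlam n).le _) (sq_nonneg _)
    · exact sum_lam_rpow_le hL (by linarith) q
  set S := ∑ n ∈ Finset.range (q + 2), lam L (n - 1) ^ (-1 + d) * β n ^ 2 with hS
  have hS0 : 0 ≤ S :=
    Finset.sum_nonneg fun n _ => mul_nonneg (Real.rpow_nonneg (hlam n).le _) (sq_nonneg _)
  have h4 : lam L q ^ (d + 1) * (c₀ * ν) ^ 2 ≤ wavenumberConst d * S := by
    have e : lam L q ^ (d + 1) * lam L q ^ (3 - d) = (lam L q ^ 2) ^ 2 := by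
      rw [← Real.rpow_add hl, ← pow_mul, ← Real.rpow_natCast]
      congr 1
      push_cast; ring
    calc _ ≤ lam L q ^ (d + 1) * ((lam L q ^ 2)⁻¹ *
          (A * ∑ n ∈ Finset.range (q + 2), lam L (n - 1) * β n)) ^ 2 := by gcongr
      _ = lam L q ^ (d + 1) * ((lam L q ^ 2)⁻¹) ^ 2 * A ^ 2 *
          (∑ n ∈ Finset.range (q + 2), lam L (n - 1) * β n) ^ 2 := by ring
      _ ≤ lam L q ^ (d + 1) * ((lam L q ^ 2)⁻¹) ^ 2 * A ^ 2 * ((lam L q ^ (3 - d) * K) * S) := by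
          gcongr
      _ = (lam L q ^ (d + 1) * lam L q ^ (3 - d)) * ((lam L q ^ 2)⁻¹) ^ 2 *
            (A ^ 2 * K * S) := by ring
      _ = A ^ 2 * K * S := by rw [e]; field_simp
      _ ≤ wavenumberConst d * S := by
          unfold wavenumberConst
          gcongr
          linarith
  have hW : 0 ≤ wavenumberConst d := zero_le_one.trans (one_le_wavenumberConst hd)
  calc _ = ENNReal.ofReal (lam L q ^ (d + 1) * (c₀ * ν) ^ 2) := by
        rw [ENNReal.ofReal_mul (Real.rpow_nonneg hl.le _), ENNReal.ofReal_pow (by positivity)]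
    _ ≤ ENNReal.ofReal (wavenumberConst d * S) := ENNReal.ofReal_le_ofReal h4
    _ = ENNReal.ofReal (wavenumberConst d) * ENNReal.ofReal S := ENNReal.ofReal_mul hW
    _ ≤ _ := by
        gcongr
        rw [hS, ENNReal.ofReal_sum_of_nonneg fun n _ =>
          mul_nonneg (Real.rpow_nonneg (hlam n).le _) (sq_nonneg _)]
        refine le_trans (le_of_eq (Finset.sum_congr rfl fun n _ => ?_)) (ENNReal.sum_le_tsum _)
        rw [ENNReal.ofReal_mul (Real.rpow_nonneg (hlam n).le _), ENNReal.ofReal_pow (hβ0 n), hβ,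
          ENNReal.ofReal_toReal (hχ.blockNorm_top_ne_top _ _ _)]

/-- A wavenumber `λ_q` that is not determining is bounded by a power of the square sum of the
blocks. -/
lemma IsCutoff.lam_le_of_not_isDetermining (hχ : IsCutoff χ) (hL : 0 < L) (hν : 0 < ν)
    (hc₀ : 0 < c₀) (hδ : 0 < δ) (hδd : δ ≤ d) (hd : d < 3) {q : ℕ}
    (h : ¬ IsDetermining χ L ν c₀ δ v q) :
    ENNReal.ofReal (lam L q) ≤ (ENNReal.ofReal (wavenumberConst d / (c₀ * ν) ^ 2)
      * supSquareSum χ L d (fourierCoeff L v)) ^ (1 / (d + 1)) := by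
  have key : ENNReal.ofReal (lam L q ^ (d + 1)) * ENNReal.ofReal (c₀ * ν) ^ 2
      ≤ ENNReal.ofReal (wavenumberConst d) * supSquareSum χ L d (fourierCoeff L v) := by
    unfold IsDetermining at h
    rw [not_and_or] at h
    rcases h with h | h
    · push Not at h
      obtain ⟨p, hqp, hp⟩ := h
      refine (lam_rpow_le_of_high hL hδd hqp hp).trans (le_mul_of_one_le_left zero_le ?_)
      exact ENNReal.one_le_ofReal.2 (one_le_wavenumberConst hd)
    · exact hχ.lam_rpow_le_of_low hL hν hc₀ hd (not_lt.1 h)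
  rw [one_div, ENNReal.le_rpow_inv_iff (by linarith), ENNReal.ofReal_rpow_of_pos (lam_pos hL q),
    ENNReal.ofReal_div_of_pos (by positivity), ENNReal.ofReal_pow (by positivity)]
  rw [← ENNReal.le_div_iff_mul_le (Or.inl (by simp; positivity)) (Or.inl (by simp))] at key
  refine key.trans (le_of_eq ?_)
  simp only [div_eq_mul_inv]
  ring

/-- The determining wavenumber exceeds `λ_0` by at most a power of the square sum of the blocks. -/
lemma IsCutoff.detWavenumber_le (hχ : IsCutoff χ) (hL : 0 < L) (hν : 0 < ν)
    (hc₀ : 0 < c₀) (hδ : 0 < δ) (hδd : δ ≤ d) (hd : d < 3) :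
    detWavenumber χ L ν c₀ δ v ≤ ENNReal.ofReal (lam L 0)
      + 2 * (ENNReal.ofReal (wavenumberConst d / (c₀ * ν) ^ 2)
      * supSquareSum χ L d (fourierCoeff L v)) ^ (1 / (d + 1)) := by
  classical
  set W := (ENNReal.ofReal (wavenumberConst d / (c₀ * ν) ^ 2)
      * supSquareSum χ L d (fourierCoeff L v)) ^ (1 / (d + 1)) with hW
  have hnot : ∀ q : ℕ, ¬ IsDetermining χ L ν c₀ δ v q → ENNReal.ofReal (lam L q) ≤ W := fun q hq =>
    hχ.lam_le_of_not_isDetermining hL hν hc₀ hδ hδd hd hq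
  by_cases hex : ∃ q, IsDetermining χ L ν c₀ δ v q
  · have hle : detWavenumber χ L ν c₀ δ v ≤ ENNReal.ofReal (lam L (Nat.find hex : ℕ)) :=
      sInf_le ⟨Nat.find hex, Nat.find_spec hex, rfl⟩
    refine hle.trans ?_
    rcases hq : Nat.find hex with _ | m
    · exact le_add_right le_rfl
    · have hm : ¬ IsDetermining χ L ν c₀ δ v m := Nat.find_min hex (by lia)
      refine le_add_left ?_
      have : lam L ((m + 1 : ℕ) : ℤ) = 2 * lam L m := by
        push_cast
        rw [lam_natCast_succ, lam_natCast]
      rw [this, ENNReal.ofReal_mul (by norm_num), ENNReal.ofReal_ofNat]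
      gcongr
      exact hnot m hm
  · push Not at hex
    have htop : W = ⊤ := by
      by_contra hne
      obtain ⟨m, hm⟩ := pow_unbounded_of_one_lt (W.toReal * L) (one_lt_two : (1 : ℝ) < 2)
      have h1 := ENNReal.toReal_mono hne (hnot m (hex m))
      rw [ENNReal.toReal_ofReal (lam_pos hL _).le, lam_natCast, div_le_iff₀ hL] at h1
      linarith
    rw [htop]
    simp

end Pointwise

/-! ### Time averages and the intermittency dimension -/

/-- The uniform probability measure on `[t, t + T]`. -/
def avgMeasure (T t : ℝ) : Measure ℝ := (ENNReal.ofReal T)⁻¹ • volume.restrict (Icc t (t + T))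

lemma timeAvg_eq_lintegral (T : ℝ) (g : ℝ → ℝ≥0∞) (t : ℝ) :
    timeAvg T g t = ∫⁻ τ, g τ ∂(avgMeasure T t) := by
  rw [avgMeasure, lintegral_smul_measure, timeAvg, smul_eq_mul]

lemma isProbabilityMeasure_avgMeasure {T : ℝ} (hT : 0 < T) (t : ℝ) :
    IsProbabilityMeasure (avgMeasure T t) := by
  refine ⟨?_⟩
  rw [avgMeasure, Measure.smul_apply, Measure.restrict_apply_univ, Real.volume_Icc,
    add_sub_cancel_left, smul_eq_mul,
    ENNReal.inv_mul_cancel (by simpa using hT) ENNReal.ofReal_ne_top]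

/-- **Jensen's inequality** for the concave function `y ↦ y^{1/p}`. -/
lemma lintegral_rpow_one_div_le {Ω : Type*} [MeasurableSpace Ω] {μ : Measure Ω}
    [IsProbabilityMeasure μ] {g : Ω → ℝ≥0∞} (hg : Measurable g) {p : ℝ} (hp : 1 ≤ p) :
    ∫⁻ w, g w ^ (1 / p) ∂μ ≤ (∫⁻ w, g w ∂μ) ^ (1 / p) := by
  have hp0 : 0 < p := zero_lt_one.trans_le hp
  have h := eLpNorm'_le_eLpNorm'_of_exponent_le (f := fun w => g w ^ (1 / p)) zero_lt_one hp μ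
    (hg.pow_const _).aestronglyMeasurable
  simpa [eLpNorm', ← ENNReal.rpow_mul, hp0.ne'] using h

/-- The supremum in the definition of the intermittency dimension is attained, if the dimension
is neither `0` nor `3`, which are the values of a supremum of a set that is empty or unbounded, and
of the dimension of the trivial solution. Each partial sum of the series is continuous in the
exponent. -/
lemma supSquareSum_avg_le {χ : E3 → ℝ} {CB L T d t : ℝ} {u : ℝ → E3 → E3} (hL : 0 < L)
    (hmeas : ∀ q, Measurable fun τ => blockNorm χ L ⊤ (fourierCoeff L (u τ)) q)
    (hfin : timeAvg T (fun τ => ∑' n : ℕ, ENNReal.ofReal (lam L (n - 1) ^ 2)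
      * blockNorm χ L 2 (fourierCoeff L (u τ)) (n - 1) ^ 2) t ≠ ⊤)
    (hd0 : 0 < d) (hd3 : d < 3) (hdim : intermittencyDim χ CB L T u t = d) :
    timeAvg T (fun τ => supSquareSum χ L d (fourierCoeff L (u τ))) t
      ≤ ENNReal.ofReal (CB ^ (3 - d) * lam L 0 ^ d)
        * timeAvg T (fun τ => ∑' n : ℕ, ENNReal.ofReal (lam L (n - 1) ^ 2)
          * blockNorm χ L 2 (fourierCoeff L (u τ)) (n - 1) ^ 2) t := by
  set R := timeAvg T (fun τ => ∑' n : ℕ, ENNReal.ofReal (lam L (n - 1) ^ 2)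
      * blockNorm χ L 2 (fourierCoeff L (u τ)) (n - 1) ^ 2) t with hR
  unfold intermittencyDim at hdim
  split_ifs at hdim with h0
  · linarith
  set A := {s : ℝ | timeAvg T (fun τ => ∑' n : ℕ, ENNReal.ofReal (lam L (n - 1) ^ (-1 + s))
        * blockNorm χ L ⊤ (fourierCoeff L (u τ)) (n - 1) ^ 2) t
      ≤ ENNReal.ofReal (CB ^ (3 - s) * lam L 0 ^ s) * R} with hA
  have hne : A.Nonempty := by
    by_contra h
    rw [not_nonempty_iff_eq_empty.1 h, Real.sSup_empty] at hdim
    exact hd0.ne hdim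
  have hbdd : BddAbove A := by
    by_contra h
    rw [Real.sSup_of_not_bddAbove h] at hdim
    exact hd0.ne hdim
  obtain ⟨s, -, hlim, hsA⟩ := exists_seq_tendsto_sSup hne hbdd
  rw [hdim] at hlim
  have hlam : ∀ n : ℕ, 0 < lam L (n - 1) := fun n => lam_pos hL _
  have hsum : ∀ r : ℝ, timeAvg T (fun τ => ∑' n : ℕ, ENNReal.ofReal (lam L (n - 1) ^ (-1 + r))
        * blockNorm χ L ⊤ (fourierCoeff L (u τ)) (n - 1) ^ 2) t
      = ∑' n : ℕ, ENNReal.ofReal (lam L (n - 1) ^ (-1 + r))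
        * timeAvg T (fun τ => blockNorm χ L ⊤ (fourierCoeff L (u τ)) (n - 1) ^ 2) t := by
    intro r
    simp_rw [timeAvg_eq_lintegral]
    rw [lintegral_tsum fun n => (((hmeas _).pow_const 2).const_mul _).aemeasurable]
    exact tsum_congr fun n => lintegral_const_mul _ ((hmeas _).pow_const 2)
  change timeAvg T (fun τ => ∑' n : ℕ, ENNReal.ofReal (lam L (n - 1) ^ (-1 + d))
        * blockNorm χ L ⊤ (fourierCoeff L (u τ)) (n - 1) ^ 2) t ≤ _
  rw [hsum]
  refine ENNReal.tsum_le_of_sum_range_le fun N => ?_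
  refine le_of_tendsto_of_tendsto' (f := fun m => ∑ n ∈ Finset.range N,
      ENNReal.ofReal (lam L (n - 1) ^ (-1 + s m))
        * timeAvg T (fun τ => blockNorm χ L ⊤ (fourierCoeff L (u τ)) (n - 1) ^ 2) t)
    (g := fun m => ENNReal.ofReal (CB ^ (3 - s m) * lam L 0 ^ s m) * R) (b := Filter.atTop)
    ?_ ?_ fun m => ?_
  · refine tendsto_finsetSum _ fun n _ => ENNReal.Tendsto.mul_const (ENNReal.tendsto_ofReal ?_)
      (Or.inl ?_)
    · exact ((Real.continuousAt_const_rpow (hlam n).ne').tendsto).comp (hlim.const_add (-1))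
    · rw [ne_eq, ENNReal.ofReal_eq_zero, not_le]
      exact Real.rpow_pos_of_pos (hlam n) _
  · refine ENNReal.Tendsto.mul_const (ENNReal.tendsto_ofReal ?_) (Or.inr hfin)
    refine Filter.Tendsto.mul ?_ ?_
    · exact ((Real.continuousAt_const_rpow' (by linarith)).tendsto).comp (hlim.const_sub 3)
    · exact ((Real.continuousAt_const_rpow (lam_pos hL 0).ne').tendsto).comp hlim
  · have := hsA m
    rw [hA, mem_ofPred_eq, hsum] at this
    exact (ENNReal.sum_le_tsum _).trans this

/-! ### The averaged bound of the determining wavenumber -/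

/-- The constant in the bound of the averaged determining wavenumber; `M` bounds the cut-off. -/
def averageConst (CB c₀ d M : ℝ) : ℝ :=
  2 * (wavenumberConst d / c₀ ^ 2 * |CB ^ (3 - d)| * (5 * M ^ 2)) ^ (1 / (d + 1)) + 1

lemma timeAvg_gradNormSq_ne_top {L ν T : ℝ} {f : ℝ → Freq → C3} {u : ℝ → E3 → E3} (hT : 0 < T)
    (hu : IsCompleteLerayHopf ν L f u) (t : ℝ) : timeAvg T (fun τ => gradNormSq L (u τ)) t ≠ ⊤ :=
  ENNReal.mul_ne_top (ENNReal.inv_ne_top.2 (by simpa using hT))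
    (hu.lintegral_gradNormSq_lt_top _ _).ne

lemma IsCutoff.timeAvg_detWavenumber_le {χ : E3 → ℝ} (hχ : IsCutoff χ) {M : ℝ}
    (hM : ∀ ξ, χ ξ ≤ M) {CB δ c₀ d L ν T t : ℝ} (hδ : 0 < δ) (hc₀ : 0 < c₀) (hδd : δ ≤ d)
    (hd : d < 3) (hL : 0 < L) (hν : 0 < ν) (hT : 0 < T) {f : ℝ → Freq → C3} {u : ℝ → E3 → E3}
    (hu : IsCompleteLerayHopf ν L f u) (hdim : intermittencyDim χ CB L T u t = d) :
    timeAvg T (fun τ => detWavenumber χ L ν c₀ δ (u τ)) t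
      ≤ ENNReal.ofReal (lam L 0 + averageConst CB c₀ d M * kolmogorovWavenumber L ν T d u t) := by
  have hd0 : 0 < d := hδ.trans_le hδd
  have hμ := isProbabilityMeasure_avgMeasure hT t
  have hlam := lam_pos hL 0
  have hmeas : ∀ q, Measurable fun τ => blockNorm χ L ⊤ (fourierCoeff L (u τ)) q := fun q =>
    hχ.measurable_blockNorm_top hL hu.continuous_fourierCoeff q
  set D := timeAvg T (fun τ => gradNormSq L (u τ)) t with hD
  have hDfin : D ≠ ⊤ := timeAvg_gradNormSq_ne_top hT hu t
  set R := timeAvg T (fun τ => ∑' n : ℕ, ENNReal.ofReal (lam L (n - 1) ^ 2)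
      * blockNorm χ L 2 (fourierCoeff L (u τ)) (n - 1) ^ 2) t with hR
  have hRD : R ≤ ENNReal.ofReal (5 * M ^ 2) * D := by
    rw [hR, hD, timeAvg_eq_lintegral, timeAvg_eq_lintegral,
      ← lintegral_const_mul _ hu.measurable_gradNormSq]
    exact lintegral_mono fun τ => hχ.tsum_lam_sq_blockNorm_le hM hL (hu.fourierCoeff_zero τ)
  have hRfin : R ≠ ⊤ :=
    ne_top_of_le_ne_top (ENNReal.mul_ne_top ENNReal.ofReal_ne_top hDfin) hRD
  have hS := supSquareSum_avg_le hL hmeas hRfin hd0 hd hdim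
  rw [timeAvg_eq_lintegral] at hS
  have hSmeas : Measurable fun τ => supSquareSum χ L d (fourierCoeff L (u τ)) :=
    Measurable.tsum fun n => ((hmeas _).pow_const 2).const_mul _
  set k := wavenumberConst d / (c₀ * ν) ^ 2 with hk
  have hW0 : 0 < wavenumberConst d := zero_lt_one.trans_le (one_le_wavenumberConst hd)
  have hk0 : 0 < k := by positivity
  set Dr := D.toReal with hDr
  have hDr0 : 0 ≤ Dr := ENNReal.toReal_nonneg
  set B := |CB ^ (3 - d)| with hB
  have hmain : (∫⁻ τ, ENNReal.ofReal k * supSquareSum χ L d (fourierCoeff L (u τ))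
        ∂(avgMeasure T t))
      ≤ ENNReal.ofReal (k * (B * lam L 0 ^ d * (5 * M ^ 2 * Dr))) := by
    rw [lintegral_const_mul _ hSmeas, ENNReal.ofReal_mul (by positivity)]
    gcongr
    refine hS.trans ?_
    rw [ENNReal.ofReal_mul (p := B * lam L 0 ^ d) (by positivity),
      ENNReal.ofReal_mul (p := 5 * M ^ 2) (by positivity),
      hDr, ENNReal.ofReal_toReal hDfin]
    gcongr
    exact le_abs_self _
  have hreal : 2 * (k * (B * lam L 0 ^ d * (5 * M ^ 2 * Dr))) ^ (1 / (d + 1))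
      ≤ averageConst CB c₀ d M * kolmogorovWavenumber L ν T d u t := by
    unfold averageConst kolmogorovWavenumber dissipationRate
    have e : k * (B * lam L 0 ^ d * (5 * M ^ 2 * Dr))
        = (wavenumberConst d / c₀ ^ 2 * B * (5 * M ^ 2)) * (lam L 0 ^ d * ν * Dr / ν ^ 3) := by
      rw [hk]; field_simp
    rw [e, Real.mul_rpow (by positivity) (by positivity), add_mul, ← mul_assoc]
    exact le_add_of_nonneg_right (by positivity)
  rw [timeAvg_eq_lintegral]
  calc _ ≤ ∫⁻ τ, (ENNReal.ofReal (lam L 0) + 2 * (ENNReal.ofReal k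
          * supSquareSum χ L d (fourierCoeff L (u τ))) ^ (1 / (d + 1))) ∂(avgMeasure T t) :=
        lintegral_mono fun τ => hχ.detWavenumber_le hL hν hc₀ hδ hδd hd
    _ = ENNReal.ofReal (lam L 0) + 2 * ∫⁻ τ, (ENNReal.ofReal k
          * supSquareSum χ L d (fourierCoeff L (u τ))) ^ (1 / (d + 1)) ∂(avgMeasure T t) := by
        rw [lintegral_add_left measurable_const, lintegral_const, measure_univ, mul_one,
          lintegral_const_mul _ ((hSmeas.const_mul _).pow_const _)]
    _ ≤ ENNReal.ofReal (lam L 0)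
          + 2 * (ENNReal.ofReal (k * (B * lam L 0 ^ d * (5 * M ^ 2 * Dr)))) ^ (1 / (d + 1)) := by
        gcongr
        refine (lintegral_rpow_one_div_le (hSmeas.const_mul _) (by linarith)).trans ?_
        gcongr
    _ = ENNReal.ofReal (lam L 0
          + 2 * (k * (B * lam L 0 ^ d * (5 * M ^ 2 * Dr))) ^ (1 / (d + 1))) := by
        rw [ENNReal.ofReal_add hlam.le (by positivity), ENNReal.ofReal_mul (p := 2) (by norm_num),
          ENNReal.ofReal_ofNat, ENNReal.ofReal_rpow_of_nonneg (by positivity) (by positivity)]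
    _ ≤ _ := ENNReal.ofReal_le_ofReal (by linarith)

end NSE

end

theorem mainTheorem2
    (χ : NSE.E3 → ℝ) (hχ : NSE.IsCutoff χ)
    (CB : ℝ) (hCB : NSE.IsBernsteinConstant χ CB)
    (δ c₀ d : ℝ) (hδ : 0 < δ) (hc₀ : 0 < c₀) (hδd : δ ≤ d) (hd : d < 3) :
    ∃ C : ℝ, 0 < C ∧
      ∀ L ν T : ℝ, 0 < L → 0 < ν → 0 < T →
      ∀ f : ℝ → NSE.Freq → NSE.C3, NSE.IsForce χ L f →
      ∀ u : ℝ → NSE.E3 → NSE.E3, NSE.IsCompleteLerayHopf ν L f u → NSE.IsBoundedL2 L u →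
      ∀ t : ℝ, NSE.intermittencyDim χ CB L T u t = d →
        AEMeasurable (fun τ => NSE.detWavenumber χ L ν c₀ δ (u τ))
            (volume.restrict (Icc t (t + T))) ∧
        NSE.timeAvg T (fun τ => NSE.detWavenumber χ L ν c₀ δ (u τ)) t
            ≤ ENNReal.ofReal (NSE.lam L 0 + C * NSE.kolmogorovWavenumber L ν T d u t) ∧
        C * NSE.kolmogorovWavenumber L ν T d u t
            ≤ C * NSE.grashofBound L ν T d (NSE.grashof χ L ν T f) ∧
        (∀ F : NSE.Freq → NSE.C3, f = (fun _ => F) →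
          C * NSE.kolmogorovWavenumber L ν T d u t
            ≤ C * NSE.grashofBound L ν T d (NSE.grashofAutonomous χ L ν F)) := by
  obtain ⟨M, -, hM⟩ := hχ.exists_bound
  have hC : 0 < NSE.averageConst CB c₀ d M := by
    have : 0 < NSE.wavenumberConst d := zero_lt_one.trans_le (NSE.one_le_wavenumberConst hd)
    unfold NSE.averageConst
    positivity
  refine ⟨_, hC, fun L ν T hL hν hT f hf u hu hb t hdim => ⟨?_, ?_, ?_, ?_⟩⟩
  · exact (hχ.measurable_detWavenumber hL ν c₀ δ hu.continuous_fourierCoeff).aemeasurable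
  · exact hχ.timeAvg_detWavenumber_le hM hδ hc₀ hδd hd hL hν hT hu hdim
  · gcongr
    exact NSE.kolmogorovWavenumber_le_grashofBound hL hν hT (hδ.trans_le hδd)
      (NSE.grashof_nonneg hL hν hT) (NSE.dissipation_le_grashof hχ hL hν hT hf hu hb t)
  · rintro F rfl
    gcongr
    exact NSE.kolmogorovWavenumber_le_grashofBound hL hν hT (hδ.trans_le hδd)
      (NSE.grashofAutonomous_nonneg hL)
      (NSE.dissipation_le_grashofAutonomous hχ hL hν hT hf hu hb t)
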